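/- Let $\mathcal{E}=(\mathcal{A},\mathcal{S})$ be an exact category in the sense of Quillen whose underlying additive category $\mathcal{A}$ is idempotent complete. Full subcategories are understood to be closed under isomorphism, and $\operatorname{Ext}^i_{\mathcal{E}}$ ($i\ge 1$) denotes Yoneda extensions. Write $\operatorname{pdim} X\le m$ if $\operatorname{Ext}^{m+1}_{\mathcal{E}}(X,-)=0$, and let $\mathcal{P}^{<\infty}$ be the full subcategory of objects $X$ with $\operatorname{pdim}X\le m$ for some $m\in\mathbb{N}_0$. A full subcategory is thick if it is closed under direct summands and contains all three terms of a short exact sequence as soon as it contains two of them; $\operatorname{Thick}(\mathcal{X})$ is the smallest thick subcategory containing $\mathcal{X}$. For a full subcategory $\mathcal{T}$ put $\mathcal{T}^{\perp}=\{M \mid \operatorname{Ext}^i_{\mathcal{E}}(T,M)=0 \text{ for all } i\ge 1,\ T\in\mathcal{T}\}$, and let $\operatorname{Cores}_n(\mathcal{X})$ be the full subcategory of objects $M$ admitting an exact sequence $0\to M\to X_0\to\cdots\to X_n\to 0$ with all $X_i\in\mathcal{X}$. For $n\ge 0$, a full subcategory $\mathcal{T}$ of $\mathcal{E}$ is $n$-tilting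 if (T1) $\mathcal{T}\subseteq\mathcal{T}^{\perp}$, the category $\mathcal{T}^{\perp}$ has enough projectives, and the Ext-projective objects of $\mathcal{T}^{\perp}$ are exactly the objects of $\mathcal{T}$; (T2) $\mathcal{T}^{\perp}$ is closed under extensions and under cokernels of inflations, every object of $\mathcal{E}$ admits an inflation into an object of $\mathcal{T}^{\perp}$, and $\operatorname{Cores}_n(\mathcal{T}^{\perp})=\mathcal{E}$. Let $n\ge 0$ and let $\mathcal{T}$ be an $n$-tilting subcategory of $\mathcal{E}$. Then \[ \operatorname{Thick}(\mathcal{T})=\mathcal{P}^{<\infty}. \] Moreover, $\mathcal{P}^{<\infty}$ is closed under extensions in $\mathcal{E}$ and, with the short exact sequences of $\mathcal{E}$ all of whose terms lie in $\mathcal{P}^{<\infty}$, is an idempotent complete exact category, and $\mathcal{T}$ is an $n$-tilting subcategory of $\mathcal{P}^{<\infty}$ (where $\operatorname{Ext}$, $\mathcal{T}^{\perp}$ and $\operatorname{Cores}_n$ are now formed in $\mathcal{P}^{<\infty}$). -/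

import Mathlib

open CategoryTheory CategoryTheory.Limits

universe v u

namespace QuillenExact

variable {C : Type u} [Category.{v} C] [Preadditive C]

/-- A morphism is an inflation if it is the first map of a sequence in the class `S`. -/
def IsInflation (S : ObjectProperty (ShortComplex C)) {A B : C} (i : A ⟶ B) : Prop :=
  ∃ (X : C) (p : B ⟶ X) (w : i ≫ p = 0), S (ShortComplex.mk i p w)

/-- A morphism is a deflation if it is the second map of a sequence in the class `S`. -/
def IsDeflation (S : ObjectProperty (ShortComplex C)) {B X : C} (p : B ⟶ X) : Prop :=
  ∃ (A : C) (i : A ⟶ B) (w : i ≫ p = 0), S (ShortComplex.mk i p w)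

/-- `(C, S)` is an exact category in the sense of Quillen: `C` is additive and `S` is a class of
kernel-cokernel pairs (the short exact sequences), closed under isomorphisms, which satisfies the
axioms E0, E1, E2 and their duals. -/
structure IsExactCategory (S : ObjectProperty (ShortComplex C)) : Prop where
  hasFiniteBiproducts : HasFiniteBiproducts C
  isKernel : ∀ c : ShortComplex C, S c → Nonempty (IsLimit (KernelFork.ofι c.f c.zero))
  isCokernel : ∀ c : ShortComplex C, S c → Nonempty (IsColimit (CokernelCofork.ofπ c.g c.zero))
  closedUnderIso : S.IsClosedUnderIsomorphisms
  inflation_id : ∀ A : C, IsInflation S (𝟙 A)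
  deflation_id : ∀ A : C, IsDeflation S (𝟙 A)
  inflation_comp : ∀ {A B D : C} (i : A ⟶ B) (j : B ⟶ D),
    IsInflation S i → IsInflation S j → IsInflation S (i ≫ j)
  deflation_comp : ∀ {A B D : C} (p : A ⟶ B) (q : B ⟶ D),
    IsDeflation S p → IsDeflation S q → IsDeflation S (p ≫ q)
  inflation_pushout : ∀ {A B A' : C} (i : A ⟶ B) (f : A ⟶ A'), IsInflation S i →
    ∃ (B' : C) (g : B ⟶ B') (i' : A' ⟶ B'), IsPushout i f g i' ∧ IsInflation S i'
  deflation_pullback : ∀ {B D D' : C} (p : B ⟶ D) (f : D' ⟶ D), IsDeflation S p →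
    ∃ (B' : C) (g : B' ⟶ B) (p' : B' ⟶ D'), IsPullback g p' p f ∧ IsDeflation S p'

/-- The class of sequences in the full subcategory `P` that are short exact in `(C, S)`. -/
def restrict (S : ObjectProperty (ShortComplex C)) (P : ObjectProperty C) :
    ObjectProperty (ShortComplex P.FullSubcategory) :=
  S.inverseImage P.ι.mapShortComplex

/-- `NExtension S n X Y`, for `n ≥ 1`, is the type of `n`-fold extensions
`0 ⟶ Y ⟶ Eₙ ⟶ ⋯ ⟶ E₁ ⟶ X ⟶ 0`, that is, of exact sequences, each presented together with the short
exact sequences it is spliced from. (There is no constructor for `n = 0`: this index is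
never used.) -/
inductive NExtension (S : ObjectProperty (ShortComplex C)) : ℕ → C → C → Type (max u v)
  /-- a short exact sequence `Y ⟶ E ⟶ X` -/
  | single {X Y : C} (E : C) (i : Y ⟶ E) (p : E ⟶ X) (w : i ≫ p = 0)
      (h : S (ShortComplex.mk i p w)) : NExtension S 1 X Y
  /-- a short exact sequence `K ⟶ E ⟶ X` spliced with an `(n + 1)`-fold extension of `K` by `Y` -/
  | splice {n : ℕ} {X Y : C} (K E : C) (i : K ⟶ E) (p : E ⟶ X) (w : i ≫ p = 0)
      (h : S (ShortComplex.mk i p w)) (ξ : NExtension S (n + 1) K Y) : NExtension S (n + 2) X Y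

/-- `NExtension.Map a ξ ξ'`: there is a morphism of exact sequences from `ξ` to `ξ'` which is
`a : X ⟶ X'` on the right end and the identity of `Y` on the left end. -/
inductive NExtension.Map {S : ObjectProperty (ShortComplex C)} :
    {n : ℕ} → {X X' Y : C} → (X ⟶ X') → NExtension S n X Y → NExtension S n X' Y → Prop
  | single {X X' Y E E' : C} {i : Y ⟶ E} {p : E ⟶ X} {w : i ≫ p = 0}
      {h : S (ShortComplex.mk i p w)} {i' : Y ⟶ E'} {p' : E' ⟶ X'} {w' : i' ≫ p' = 0}
      {h' : S (ShortComplex.mk i' p' w')} (a : X ⟶ X') (e : E ⟶ E')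
      (hi : i ≫ e = i') (hp : e ≫ p' = p ≫ a) :
      NExtension.Map a (NExtension.single E i p w h) (NExtension.single E' i' p' w' h')
  | splice {n : ℕ} {X X' Y K K' E E' : C} {i : K ⟶ E} {p : E ⟶ X} {w : i ≫ p = 0}
      {h : S (ShortComplex.mk i p w)} {i' : K' ⟶ E'} {p' : E' ⟶ X'} {w' : i' ≫ p' = 0}
      {h' : S (ShortComplex.mk i' p' w')}
      {ξ : NExtension S (n + 1) K Y} {ξ' : NExtension S (n + 1) K' Y}
      (a : X ⟶ X') (e : E ⟶ E') (k : K ⟶ K')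
      (hi : i ≫ e = k ≫ i') (hp : e ≫ p' = p ≫ a) (hξ : NExtension.Map k ξ ξ') :
      NExtension.Map a (NExtension.splice K E i p w h ξ) (NExtension.splice K' E' i' p' w' h' ξ')

/-- The Yoneda extensions `Extⁿ(X, Y)`, `n ≥ 1`, of `(C, S)`: `n`-fold extensions modulo the
equivalence relation generated by the morphisms that are the identity on both ends.
Since this contains the class of the trivial extension, the group `Extⁿ(X, Y)` vanishes if and only
if `Ext S n X Y` is a subsingleton. -/
def Ext (S : ObjectProperty (ShortComplex C)) (n : ℕ) (X Y : C) : Type (max u v) :=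
  Quot (fun ξ ξ' : NExtension S n X Y => NExtension.Map (𝟙 X) ξ ξ')

/-- The right perpendicular category `T^⊥` of all `M` with `Extⁱ(X, M) = 0` for all `i ≥ 1` and all
`X` in `T`. -/
def perp (S : ObjectProperty (ShortComplex C)) (T : ObjectProperty C) : ObjectProperty C :=
  fun M => ∀ i : ℕ, 1 ≤ i → ∀ X : C, T X → Subsingleton (Ext S i X M)

/-- The projective dimension of `X` is at most `n`: the functor `Extⁿ⁺¹(X, -)` is zero. -/
def ProjDimLE (S : ObjectProperty (ShortComplex C)) (n : ℕ) (X : C) : Prop :=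
  ∀ Y : C, Subsingleton (Ext S (n + 1) X Y)

/-- The full subcategory of the objects of finite projective dimension. -/
def finiteProjDim (S : ObjectProperty (ShortComplex C)) : ObjectProperty C :=
  fun X => ∃ n : ℕ, ProjDimLE S n X

/-- Closure under extensions. -/
def ExtensionClosed (S : ObjectProperty (ShortComplex C)) (L : ObjectProperty C) : Prop :=
  ∀ c : ShortComplex C, S c → L c.X₁ → L c.X₃ → L c.X₂

/-- Closure under cokernels of inflations. -/
def InflationClosed (S : ObjectProperty (ShortComplex C)) (L : ObjectProperty C) : Prop :=
  ∀ c : ShortComplex C, S c → L c.X₁ → L c.X₂ → L c.X₃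

/-- Closure under kernels of deflations. -/
def DeflationClosed (S : ObjectProperty (ShortComplex C)) (L : ObjectProperty C) : Prop :=
  ∀ c : ShortComplex C, S c → L c.X₂ → L c.X₃ → L c.X₁

/-- Thick subcategories: closed under direct summands (in an idempotent complete category these are
the retracts) and satisfying two-out-of-three on short exact sequences. -/
structure IsThick (S : ObjectProperty (ShortComplex C)) (L : ObjectProperty C) : Prop where
  summands : L.IsStableUnderRetracts
  extensionClosed : ExtensionClosed S L
  inflationClosed : InflationClosed S L
  deflationClosed : DeflationClosed S L

/-- The smallest thick subcategory containing `X`. -/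
def Thick (S : ObjectProperty (ShortComplex C)) (X : ObjectProperty C) : ObjectProperty C :=
  fun M => ∀ L : ObjectProperty C, IsThick S L → X ≤ L → L M

/-- The Ext-projective objects of the subcategory `X`. -/
def extProjectives (S : ObjectProperty (ShortComplex C)) (X : ObjectProperty C) :
    ObjectProperty C :=
  fun P => X P ∧ ∀ M : C, X M → Subsingleton (Ext S 1 P M)

/-- The subcategory `X` has enough projectives: every `M` in `X` is the end of a short exact
sequence `K ⟶ P ⟶ M` with all terms in `X` and `P` Ext-projective in `X`. -/
def HasEnoughProjectives (S : ObjectProperty (ShortComplex C)) (X : ObjectProperty C) : Prop :=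
  ∀ M : C, X M → ∃ (K P : C) (i : K ⟶ P) (p : P ⟶ M) (w : i ≫ p = 0),
    S (ShortComplex.mk i p w) ∧ X K ∧ extProjectives S X P

/-- `Coresₙ(X)`: the objects `M` with an exact sequence `0 ⟶ M ⟶ X₀ ⟶ ⋯ ⟶ Xₙ ⟶ 0` with all `Xᵢ`
in `X`. -/
def Cores (S : ObjectProperty (ShortComplex C)) (X : ObjectProperty C) : ℕ → ObjectProperty C
  | 0 => fun M => ∃ X₀ : C, X X₀ ∧ Nonempty (M ≅ X₀)
  | n + 1 => fun M => ∃ (X₀ N : C) (i : M ⟶ X₀) (p : X₀ ⟶ N) (w : i ≫ p = 0),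
      S (ShortComplex.mk i p w) ∧ X X₀ ∧ Cores S X n N

/-- Coresolving subcategories: closed under extensions and under cokernels of inflations, and such
that every object admits an inflation into an object of the subcategory. -/
structure IsCoresolving (S : ObjectProperty (ShortComplex C)) (X : ObjectProperty C) : Prop where
  extensionClosed : ExtensionClosed S X
  inflationClosed : InflationClosed S X
  cogenerating : ∀ M : C, ∃ (X₀ : C) (i : M ⟶ X₀), X X₀ ∧ IsInflation S i

/-- Tilting subcategories: `T` is self-orthogonal, `T^⊥` has enough projectives, these are given
by `T`, and `T^⊥` is finitely coresolving. -/
structure IsTilting (S : ObjectProperty (ShortComplex C)) (T : ObjectProperty C) : Prop where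
  selfOrthogonal : T ≤ perp S T
  enoughProjectives : HasEnoughProjectives S (perp S T)
  projectives_eq : extProjectives S (perp S T) = T
  coresolving : IsCoresolving S (perp S T)
  finitelyCoresolving : ∀ M : C, ∃ n : ℕ, 1 ≤ n ∧ Cores S (perp S T) n M

/-- `n`-tilting subcategories: tilting subcategories `T` with `Coresₙ(T^⊥)` everything. -/
structure IsNTilting (S : ObjectProperty (ShortComplex C)) (n : ℕ) (T : ObjectProperty C) : Prop
    extends IsTilting S T where
  cores_eq_top : ∀ M : C, Cores S (perp S T) n M

end QuillenExact

/-!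
The only real work lies in handling Yoneda extensions of an exact category without enough
projectives or injectives. No group structure is put on them; all that matters is when a class
vanishes. For an `n`-fold extension `ξ` of `X` by `Y` and a map `a : X' ⟶ X`, the predicate
`ξ.TrivAlong a` describes recursively, in terms of short exact sequences and lifts, when the
pullback of `ξ` along `a` is trivial. It is additive in `a` and invariant under morphisms of
extensions (`IsExactCategory.trivAlong_iff_of_map`), so that `Extⁿ(X, Y)` vanishes if and only if
all extensions are trivial along the identity (`IsExactCategory.subsingleton_ext_iff`). From this
description one reads off the exactness of the long exact sequence in the first variable
(`IsExactCategory.exists_pull_eq_of_triv_splice`, `IsExactCategory.exists_pull_eq_of_triv`,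
`IsExactCategory.exists_splice_eq_of_triv`), and what is needed of the one in the second variable
(`IsExactCategory.exists_pushforward_of_ses`, `IsExactCategory.exists_cosyzygy_trivAlong_imp`).

Consequently the objects of finite projective dimension form a thick subcategory `𝒫`, which is then
an idempotent complete exact category. By dimension shifting along the coresolutions by objects of
`T^⊥`, the objects of `T` have projective dimension at most `n`, whence `Thick(T) ⊆ 𝒫`.

Conversely, by induction on the length of a coresolution of `M` by objects of `T^⊥`, there are
approximations `0 ⟶ K ⟶ Z ⟶ M ⟶ 0` and `0 ⟶ M ⟶ E ⟶ Y ⟶ 0` with `K` and `E` in `T^⊥` and with `Z`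
and `Y` finitely coresolved by `T`, hence in `Thick(T)`. If `M` lies in `𝒫`, so does `K`; and an
object of `T^⊥` of finite projective dimension has a finite resolution by objects of `T`, since
these are the projectives of `T^⊥`. Hence `K`, and with it `M`, lies in `Thick(T)`.

The same approximations show that `T` is tilting in `𝒫`: the objects of `𝒫` in `T^⊥` are coresolving
in `𝒫`, so that the vanishing of `Ext¹` suffices to see that they belong to the perpendicular
category formed in `𝒫`; and an object `M` of the latter is a direct summand of `E`, as `Ext¹(Y, M)`
vanishes in `𝒫`. So the two perpendicular categories agree (`IsNTilting.perp_restrict`).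
-/

namespace QuillenExact

section

variable {C : Type u} [Category.{v} C] [Preadditive C] {S : ObjectProperty (ShortComplex C)}

/-! ### Short exact sequences in an exact category -/

/-- `SES S i p`: the sequence `i`, `p` is short exact in `(C, S)`. The equation `i ≫ p = 0` is part
of the assertion, so that no proof of it has to be supplied. -/
def SES (S : ObjectProperty (ShortComplex C)) {K E X : C} (i : K ⟶ E) (p : E ⟶ X) : Prop :=
  ∃ w : i ≫ p = 0, S (ShortComplex.mk i p w)

lemma SES.zero {K E X : C} {i : K ⟶ E} {p : E ⟶ X} (h : SES S i p) : i ≫ p = 0 := h.choose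

lemma SES.isInflation {K E X : C} {i : K ⟶ E} {p : E ⟶ X} (h : SES S i p) : IsInflation S i :=
  ⟨X, p, h⟩

lemma SES.isDeflation {K E X : C} {i : K ⟶ E} {p : E ⟶ X} (h : SES S i p) : IsDeflation S p :=
  ⟨K, i, h⟩

namespace IsExactCategory

variable (hS : IsExactCategory S)
include hS

lemma mono {K E X : C} {i : K ⟶ E} {p : E ⟶ X} (h : SES S i p) : Mono i := by
  obtain ⟨l⟩ := hS.isKernel _ h.2
  exact ⟨fun f g hfg => Fork.IsLimit.hom_ext l hfg⟩

lemma epi {K E X : C} {i : K ⟶ E} {p : E ⟶ X} (h : SES S i p) : Epi p := by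
  obtain ⟨l⟩ := hS.isCokernel _ h.2
  exact ⟨fun f g hfg => Cofork.IsColimit.hom_ext l hfg⟩

lemma exists_lift {K E X : C} {i : K ⟶ E} {p : E ⟶ X} (h : SES S i p) {A : C} (f : A ⟶ E)
    (hf : f ≫ p = 0) : ∃ t : A ⟶ K, t ≫ i = f := by
  obtain ⟨l⟩ := hS.isKernel _ h.2
  obtain ⟨t, ht⟩ := KernelFork.IsLimit.lift' l f hf
  exact ⟨t, ht⟩

lemma exists_desc {K E X : C} {i : K ⟶ E} {p : E ⟶ X} (h : SES S i p) {A : C} (f : E ⟶ A)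
    (hf : i ≫ f = 0) : ∃ t : X ⟶ A, p ≫ t = f := by
  obtain ⟨l⟩ := hS.isCokernel _ h.2
  obtain ⟨t, ht⟩ := CokernelCofork.IsColimit.desc' l f hf
  exact ⟨t, ht⟩

lemma ses_of_iso {K E X K' E' X' : C} {i : K ⟶ E} {p : E ⟶ X} (h : SES S i p)
    {i' : K' ⟶ E'} {p' : E' ⟶ X'} (α : K ≅ K') (β : E ≅ E') (γ : X ≅ X')
    (hi : α.hom ≫ i' = i ≫ β.hom) (hp : β.hom ≫ p' = p ≫ γ.hom) : SES S i' p' := by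
  obtain ⟨w, h⟩ := h
  have w' : i' ≫ p' = 0 := by
    rw [← cancel_epi α.hom, reassoc_of% hi, hp, reassoc_of% w]
    simp
  have := hS.closedUnderIso
  exact ⟨w', S.prop_of_iso
    (ShortComplex.isoMk (S₁ := ShortComplex.mk i p w) (S₂ := ShortComplex.mk i' p' w')
      α β γ hi hp) h⟩

/-- Any other kernel of a deflation gives a short exact sequence. -/
lemma ses_of_kernel {K E X K' : C} {i : K ⟶ E} {p : E ⟶ X} (h : SES S i p) (j : K' ⟶ E) [Mono j]
    (w : j ≫ p = 0) (t : K ⟶ K') (ht : t ≫ j = i) : SES S j p := by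
  have := hS.mono h
  obtain ⟨s, hs⟩ := hS.exists_lift h j w
  refine hS.ses_of_iso h ⟨t, s, ?_, ?_⟩ (Iso.refl _) (Iso.refl _) (by simp [ht]) (by simp)
  · rw [← cancel_mono i]; simp [hs, ht]
  · rw [← cancel_mono j]; simp [hs, ht]

/-- Any other cokernel of an inflation gives a short exact sequence. -/
lemma ses_of_cokernel {K E X X' : C} {i : K ⟶ E} {p : E ⟶ X} (h : SES S i p) (q : E ⟶ X') [Epi q]
    (w : i ≫ q = 0) (t : X' ⟶ X) (ht : q ≫ t = p) : SES S i q := by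
  have := hS.epi h
  obtain ⟨s, hs⟩ := hS.exists_desc h q w
  refine hS.ses_of_iso h (Iso.refl _) (Iso.refl _) ⟨s, t, ?_, ?_⟩ (by simp) (by simp [hs])
  · rw [← cancel_epi p]; simp [reassoc_of% hs, ht]
  · rw [← cancel_epi q]; simp [reassoc_of% ht, hs]

lemma exists_ses_id (X : C) : ∃ Z : C, IsZero Z ∧ SES S (0 : Z ⟶ X) (𝟙 X) := by
  obtain ⟨Z, i, h⟩ := hS.deflation_id X
  have h : SES S i (𝟙 X) := h
  have hi : i = 0 := by simpa using h.zero
  subst hi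
  have := hS.mono h
  exact ⟨Z, (IsZero.iff_id_eq_zero Z).2 (by rw [← cancel_mono (0 : Z ⟶ X)]; simp), h⟩

lemma exists_id_ses (X : C) : ∃ Z : C, IsZero Z ∧ SES S (𝟙 X) (0 : X ⟶ Z) := by
  obtain ⟨Z, p, h⟩ := hS.inflation_id X
  have h : SES S (𝟙 X) p := h
  have hp : p = 0 := by simpa using h.zero
  subst hp
  have := hS.epi h
  exact ⟨Z, (IsZero.iff_id_eq_zero Z).2 (by rw [← cancel_epi (0 : X ⟶ Z)]; simp), h⟩

lemma ses_id_of_isZero (X : C) {Z : C} (hZ : IsZero Z) : SES S (𝟙 X) (0 : X ⟶ Z) := by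
  obtain ⟨Z', hZ', h⟩ := hS.exists_id_ses X
  exact hS.ses_of_iso h (Iso.refl _) (Iso.refl _) (hZ'.iso hZ) (by simp) (by simp)

lemma exists_ses_pullback {K E X X' : C} {i : K ⟶ E} {p : E ⟶ X} (h : SES S i p) (a : X' ⟶ X) :
    ∃ (E' : C) (i' : K ⟶ E') (p' : E' ⟶ X') (g : E' ⟶ E),
      SES S i' p' ∧ IsPullback g p' p a ∧ i' ≫ g = i := by
  obtain ⟨E', g, p', hP, A, j, hj⟩ := hS.deflation_pullback p a h.isDeflation
  have hj : SES S j p' := hj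
  have := hS.mono h
  have := hS.mono hj
  have hl : hP.lift i 0 (by simp [h.zero]) ≫ g = i := hP.lift_fst _ _ _
  have hl' : hP.lift i 0 (by simp [h.zero]) ≫ p' = 0 := hP.lift_snd _ _ _
  obtain ⟨t, ht⟩ := hS.exists_lift h (j ≫ g) (by
    rw [Category.assoc, hP.w, ← Category.assoc, hj.zero, zero_comp])
  have : Mono (hP.lift i 0 (by simp [h.zero])) := mono_of_mono_fac hl
  refine ⟨E', _, p', g, hS.ses_of_kernel hj _ hl' t ?_, hP, hl⟩
  apply hP.hom_ext
  · rw [Category.assoc, hl, ht]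
  · rw [Category.assoc, hl', hj.zero, comp_zero]

lemma exists_ses_pushout {K E X K' : C} {i : K ⟶ E} {p : E ⟶ X} (h : SES S i p) (a : K ⟶ K') :
    ∃ (E' : C) (i' : K' ⟶ E') (p' : E' ⟶ X) (g : E ⟶ E'),
      SES S i' p' ∧ IsPushout i a g i' ∧ g ≫ p' = p := by
  obtain ⟨E', g, i', hP, A, q, hq⟩ := hS.inflation_pushout i a h.isInflation
  have hq : SES S i' q := hq
  have := hS.epi h
  have := hS.epi hq
  have hl : g ≫ hP.desc p 0 (by simp [h.zero]) = p := hP.inl_desc _ _ _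
  have hl' : i' ≫ hP.desc p 0 (by simp [h.zero]) = 0 := hP.inr_desc _ _ _
  obtain ⟨t, ht⟩ := hS.exists_desc h (g ≫ q) (by
    rw [← Category.assoc, hP.w, Category.assoc, hq.zero, comp_zero])
  have : Epi (hP.desc p 0 (by simp [h.zero])) := epi_of_epi_fac hl
  refine ⟨E', i', _, g, hS.ses_of_cokernel hq _ hl' t ?_, hP, hl⟩
  apply hP.hom_ext
  · rw [← Category.assoc, hl, ht]
  · rw [← Category.assoc, hl', hq.zero, zero_comp]

/-- The kernel of a composite of deflations `Z ⟶ E ⟶ X` is the pullback of the first one along the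
kernel of the second one, and so it is an extension of the two kernels. -/
lemma exists_ses_comp {L Z K E X : C} {l : L ⟶ Z} {z : Z ⟶ E} {i : K ⟶ E} {p : E ⟶ X}
    (hz : SES S l z) (hp : SES S i p) :
    ∃ (M : C) (m : M ⟶ Z) (j : L ⟶ M) (q : M ⟶ K),
      SES S m (z ≫ p) ∧ SES S j q ∧ IsPullback m q z i ∧ j ≫ m = l := by
  obtain ⟨M, j, q, m, hj, hP, hm⟩ := hS.exists_ses_pullback hz i
  obtain ⟨A, k, hk⟩ := hS.deflation_comp z p hz.isDeflation hp.isDeflation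
  have hk : SES S k (z ≫ p) := hk
  have := hS.mono hp
  have : Mono m := ⟨fun f g hfg => hP.hom_ext hfg (by
    rw [← cancel_mono i, Category.assoc, Category.assoc, ← hP.w, reassoc_of% hfg])⟩
  obtain ⟨t, ht⟩ := hS.exists_lift hp (k ≫ z) (by rw [Category.assoc, hk.zero])
  refine ⟨M, m, j, q, hS.ses_of_kernel hk m ?_ (hP.lift k t ht.symm) (hP.lift_fst _ _ _), hj, hP,
    hm⟩
  rw [← Category.assoc, hP.w, Category.assoc, hp.zero, comp_zero]

/-- The cokernel of a composite of inflations `K ⟶ E ⟶ F` is the pushout of the second one along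
the cokernel of the first one, and so it is an extension of the two cokernels. -/
lemma exists_ses_comp' {K E X F Y : C} {i : K ⟶ E} {p : E ⟶ X} {f : E ⟶ F} {g : F ⟶ Y}
    (hi : SES S i p) (hf : SES S f g) :
    ∃ (M : C) (m : F ⟶ M) (j : X ⟶ M) (q : M ⟶ Y),
      SES S (i ≫ f) m ∧ SES S j q ∧ IsPushout f p m j ∧ m ≫ q = g := by
  obtain ⟨M, j, q, m, hj, hP, hm⟩ := hS.exists_ses_pushout hf p
  obtain ⟨A, k, hk⟩ := hS.inflation_comp i f hi.isInflation hf.isInflation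
  have hk : SES S (i ≫ f) k := hk
  have := hS.epi hi
  have : Epi m := ⟨fun f g hfg => hP.hom_ext hfg (by
    rw [← cancel_epi p, ← Category.assoc, ← Category.assoc, ← hP.w, Category.assoc, hfg,
      Category.assoc])⟩
  obtain ⟨t, ht⟩ := hS.exists_desc hi (f ≫ k) (by rw [← Category.assoc, hk.zero])
  refine ⟨M, m, j, q, hS.ses_of_cokernel hk m ?_ (hP.desc k t ht.symm) (hP.inl_desc _ _ _), hj, hP,
    hm⟩
  rw [Category.assoc, hP.w, ← Category.assoc, hi.zero, zero_comp]

/-- Split short exact sequences belong to `S`. -/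
lemma exists_ses_split (A B : C) : ∃ (P : C) (i : A ⟶ P) (p : P ⟶ B) (s : B ⟶ P) (r : P ⟶ A),
    SES S i p ∧ s ≫ p = 𝟙 B ∧ i ≫ r = 𝟙 A ∧ s ≫ r = 0 := by
  obtain ⟨Z, hZ, h⟩ := hS.exists_id_ses A
  obtain ⟨P, i, p, g, hP, hpb, hi⟩ := hS.exists_ses_pullback h (0 : B ⟶ Z)
  exact ⟨P, i, p, hpb.lift 0 (𝟙 B) (by simp), g, hP, hpb.lift_snd _ _ _, hi, hpb.lift_fst _ _ _⟩

/-- A section of the deflation of a short exact sequence gives a retraction of the inflation. -/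
lemma exists_retraction {K E X : C} {i : K ⟶ E} {p : E ⟶ X} (h : SES S i p) (s : X ⟶ E)
    (hs : s ≫ p = 𝟙 X) : ∃ r : E ⟶ K, i ≫ r = 𝟙 K ∧ r ≫ i + p ≫ s = 𝟙 E ∧ s ≫ r = 0 := by
  have := hS.mono h
  obtain ⟨r, hr⟩ := hS.exists_lift h (𝟙 E - p ≫ s) (by simp [hs])
  refine ⟨r, ?_, by simp [hr], ?_⟩
  · rw [← cancel_mono i]; simp [hr, reassoc_of% h.zero]
  · rw [← cancel_mono i]; simp [hr, reassoc_of% hs]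

/-- A retraction of the inflation of a short exact sequence gives a section of the deflation. -/
lemma exists_section {K E X : C} {i : K ⟶ E} {p : E ⟶ X} (h : SES S i p) (r : E ⟶ K)
    (hr : i ≫ r = 𝟙 K) : ∃ s : X ⟶ E, s ≫ p = 𝟙 X := by
  have := hS.epi h
  obtain ⟨s, hs⟩ := hS.exists_desc h (𝟙 E - r ≫ i) (by simp [reassoc_of% hr])
  exact ⟨s, by rw [← cancel_epi p]; simp [reassoc_of% hs, h.zero]⟩

/-- Morphisms over the base induce morphisms of kernels. -/
lemma exists_kernel_map {K E X K' E' X' : C} {i : K ⟶ E} {p : E ⟶ X} {i' : K' ⟶ E'} {p' : E' ⟶ X'}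
    (h : SES S i p) (h' : SES S i' p') (e : E ⟶ E') (a : X ⟶ X') (he : e ≫ p' = p ≫ a) :
    ∃ k : K ⟶ K', k ≫ i' = i ≫ e :=
  hS.exists_lift h' (i ≫ e) (by rw [Category.assoc, he, ← Category.assoc, h.zero, zero_comp])

end IsExactCategory

/-! ### Triviality of the pullback of an extension -/

namespace NExtension

/-- `ξ.TrivAlong a` says in elementary terms that the pullback of `ξ` along `a` has trivial class:
a short exact sequence becomes trivial along `a` if `a` lifts through its deflation, and a sequence
`K ⟶ E ⟶ X` spliced with `ξ` becomes trivial along `a : X' ⟶ X` if there are a short exact sequence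
`L ⟶ Z ⟶ X'` and a morphism from it to `K ⟶ E ⟶ X` inducing `a` such that `ξ` becomes trivial along
`L ⟶ K`. -/
def TrivAlong : ∀ {n : ℕ} {X Y : C}, NExtension S n X Y → ∀ {X' : C}, (X' ⟶ X) → Prop
  | _, _, _, .single E _ p _ _, X', a => ∃ s : X' ⟶ E, s ≫ p = a
  | _, _, _, .splice K E i p _ _ ξ, X', a =>
    ∃ (L Z : C) (l : L ⟶ Z) (z : Z ⟶ X') (e : Z ⟶ E) (k : L ⟶ K),
      SES S l z ∧ e ≫ p = z ≫ a ∧ l ≫ e = k ≫ i ∧ TrivAlong ξ k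

end NExtension

open NExtension

namespace IsExactCategory

variable (hS : IsExactCategory S)
include hS

lemma trivAlong_comp {n : ℕ} {X Y : C} {ξ : NExtension S n X Y} {X' X'' : C} {a : X' ⟶ X}
    (h : ξ.TrivAlong a) (b : X'' ⟶ X') : ξ.TrivAlong (b ≫ a) := by
  cases ξ with
  | single E i p w hE =>
    obtain ⟨s, rfl⟩ := h
    exact ⟨b ≫ s, by simp⟩
  | splice K E i p w hE ξ =>
    obtain ⟨L, Z, l, z, e, k, hz, he, hl, hk⟩ := h
    obtain ⟨Z', l', z', g, hz', hP, hg⟩ := hS.exists_ses_pullback hz b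
    exact ⟨L, Z', l', z', g ≫ e, k, hz', by rw [Category.assoc, he, reassoc_of% hP.w],
      by rw [reassoc_of% hg, hl], hk⟩

lemma trivAlong_neg {n : ℕ} {X Y : C} {ξ : NExtension S n X Y} {X' : C} {a : X' ⟶ X}
    (h : ξ.TrivAlong a) : ξ.TrivAlong (-a) := by
  simpa using hS.trivAlong_comp h (-𝟙 X')

lemma trivAlong_of_id {n : ℕ} {X Y : C} {ξ : NExtension S n X Y} (h : ξ.TrivAlong (𝟙 X)) {X' : C}
    (a : X' ⟶ X) : ξ.TrivAlong a := by
  simpa using hS.trivAlong_comp h a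

lemma trivAlong_zero {n : ℕ} {X Y : C} (ξ : NExtension S n X Y) (X' : C) :
    ξ.TrivAlong (0 : X' ⟶ X) := by
  induction ξ generalizing X' with
  | single E i p w hE => exact ⟨0, by simp⟩
  | splice K E i p w hE ξ ih =>
    obtain ⟨Z, hZ, h⟩ := hS.exists_ses_id X'
    exact ⟨Z, X', 0, 𝟙 X', 0, 0, h, by simp, by simp, ih Z⟩

/-- Extensions are effaceable: each one becomes trivial along some deflation. -/
lemma exists_trivAlong {n : ℕ} {X Y : C} (ξ : NExtension S n X Y) {X' : C} (a : X' ⟶ X) :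
    ∃ (L Z : C) (l : L ⟶ Z) (z : Z ⟶ X'), SES S l z ∧ ξ.TrivAlong (z ≫ a) := by
  cases ξ with
  | single E i p w hE =>
    obtain ⟨Z, l, z, g, hz, hP, -⟩ := hS.exists_ses_pullback ⟨w, hE⟩ a
    exact ⟨_, Z, l, z, hz, g, hP.w⟩
  | splice K E i p w hE ξ =>
    obtain ⟨Z, l, z, g, hz, hP, -⟩ := hS.exists_ses_pullback ⟨w, hE⟩ a
    obtain ⟨O, hO, h⟩ := hS.exists_ses_id Z
    exact ⟨_, Z, l, z, hz, O, Z, 0, 𝟙 Z, g, 0, h, by simp [hP.w], by simp, hS.trivAlong_zero ξ O⟩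

/-- Two deflations onto the same object have a common refinement. -/
lemma exists_common_refinement {X L₁ Z₁ L₂ Z₂ : C} {l₁ : L₁ ⟶ Z₁} {z₁ : Z₁ ⟶ X} {l₂ : L₂ ⟶ Z₂}
    {z₂ : Z₂ ⟶ X} (h₁ : SES S l₁ z₁) (h₂ : SES S l₂ z₂) :
    ∃ (L Z : C) (l : L ⟶ Z) (z : Z ⟶ X) (g₁ : Z ⟶ Z₁) (g₂ : Z ⟶ Z₂) (k₁ : L ⟶ L₁) (k₂ : L ⟶ L₂),
      SES S l z ∧ g₁ ≫ z₁ = z ∧ g₂ ≫ z₂ = z ∧ l ≫ g₁ = k₁ ≫ l₁ ∧ l ≫ g₂ = k₂ ≫ l₂ := by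
  obtain ⟨Z, l, g₁, g₂, hg₁, hP, -⟩ := hS.exists_ses_pullback h₂ z₁
  obtain ⟨M, m, j, q, hm, -, hPm, -⟩ := hS.exists_ses_comp hg₁ h₁
  obtain ⟨k₂, hk₂⟩ := hS.exists_lift h₂ (m ≫ g₂) (by rw [Category.assoc, hP.w, hm.zero])
  exact ⟨M, Z, m, g₁ ≫ z₁, g₁, g₂, q, k₂, hm, rfl, hP.w, hPm.w, hk₂.symm⟩

/-- Two trivializations are added on the fibre product of their deflations onto `X'`. -/
lemma trivAlong_add {n : ℕ} {X Y : C} {ξ : NExtension S n X Y} {X' : C} {a b : X' ⟶ X}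
    (ha : ξ.TrivAlong a) (hb : ξ.TrivAlong b) : ξ.TrivAlong (a + b) := by
  induction ξ generalizing X' with
  | single E i p w hE =>
    obtain ⟨s, rfl⟩ := ha
    obtain ⟨t, rfl⟩ := hb
    exact ⟨s + t, by simp⟩
  | splice K E i p w hE ξ ih =>
    obtain ⟨L₁, Z₁, l₁, z₁, e₁, k₁, hz₁, he₁, hl₁, hk₁⟩ := ha
    obtain ⟨L₂, Z₂, l₂, z₂, e₂, k₂, hz₂, he₂, hl₂, hk₂⟩ := hb
    obtain ⟨L, Z, l, z, g₁, g₂, q₁, q₂, hz, hg₁, hg₂, hq₁, hq₂⟩ :=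
      hS.exists_common_refinement hz₁ hz₂
    refine ⟨L, Z, l, z, g₁ ≫ e₁ + g₂ ≫ e₂, q₁ ≫ k₁ + q₂ ≫ k₂, hz, ?_, ?_,
      ih (hS.trivAlong_comp hk₁ q₁) (hS.trivAlong_comp hk₂ q₂)⟩
    · simp [he₁, he₂, reassoc_of% hg₁, reassoc_of% hg₂]
    · simp [reassoc_of% hq₁, reassoc_of% hq₂, hl₁, hl₂]

lemma trivAlong_sub {n : ℕ} {X Y : C} {ξ : NExtension S n X Y} {X' : C} {a b : X' ⟶ X}
    (ha : ξ.TrivAlong a) (hb : ξ.TrivAlong b) : ξ.TrivAlong (a - b) := by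
  rw [sub_eq_add_neg]
  exact hS.trivAlong_add ha (hS.trivAlong_neg hb)

omit hS in
lemma trivAlong_of_map {n : ℕ} {X X₂ Y : C} {f : X ⟶ X₂} {ξ : NExtension S n X Y}
    {ξ₂ : NExtension S n X₂ Y} (h : NExtension.Map f ξ ξ₂) {X' : C} {a : X' ⟶ X}
    (ha : ξ.TrivAlong a) : ξ₂.TrivAlong (a ≫ f) := by
  induction h generalizing X' with
  | single f e hi hp =>
    obtain ⟨s, rfl⟩ := ha
    exact ⟨s ≫ e, by simp [hp]⟩
  | splice f e₀ k₀ hi hp hξ ih =>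
    obtain ⟨L, Z, l, z, e, k, hz, he, hl, hk⟩ := ha
    exact ⟨L, Z, l, z, e ≫ e₀, k ≫ k₀, hz, by simp [hp, reassoc_of% he],
      by simp [reassoc_of% hl, hi], ih hk⟩

/-- Triviality is invariant under morphisms of extensions. In the inductive step a trivialization
`L ⟶ Z ⟶ X'` of the target is pulled back to the source; there, two maps to the middle term of the
target differ by a map `d` to the kernel, along which the remaining extension becomes trivial after
passing to another deflation. -/
lemma trivAlong_of_map_comp {n : ℕ} {X X₂ Y : C} {f : X ⟶ X₂} {ξ : NExtension S n X Y}
    {ξ₂ : NExtension S n X₂ Y} (h : NExtension.Map f ξ ξ₂) {X' : C} {a : X' ⟶ X}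
    (ha : ξ₂.TrivAlong (a ≫ f)) : ξ.TrivAlong a := by
  induction h generalizing X' with
  | @single X X₂ Y E E₂ i p w hE i₂ p₂ w₂ hE₂ f e hi hp =>
    have hE : SES S i p := ⟨w, hE⟩
    have hE₂ : SES S i₂ p₂ := ⟨w₂, hE₂⟩
    obtain ⟨s, hs⟩ := ha
    obtain ⟨Z, l, z, g, hz, hP, hg⟩ := hS.exists_ses_pullback hE a
    obtain ⟨r, hr⟩ := hS.exists_lift hE₂ (g ≫ e - z ≫ s) (by
      simp [hs, hp, reassoc_of% hP.w])
    have := hS.mono hE₂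
    obtain ⟨t, ht⟩ := hS.exists_section hz r (by
      rw [← cancel_mono i₂]; simp [hr, reassoc_of% hg, reassoc_of% hz.zero, hi])
    exact ⟨t ≫ g, by simp [hP.w, reassoc_of% ht]⟩
  | @splice n X X₂ Y K K₂ E E₂ i p w hE i₂ p₂ w₂ hE₂ ξ ξ₂ f e₀ k₀ hi hp hξ ih =>
    have hE : SES S i p := ⟨w, hE⟩
    have hE₂ : SES S i₂ p₂ := ⟨w₂, hE₂⟩
    obtain ⟨L, Z, l, z, e, k, hz, he, hl, hk⟩ := ha
    obtain ⟨Z', i', p', g, hp', hP, hg⟩ := hS.exists_ses_pullback hE (z ≫ a)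
    obtain ⟨d, hd⟩ := hS.exists_lift hE₂ (p' ≫ e - g ≫ e₀) (by
      simp [he, hp, reassoc_of% hP.w])
    obtain ⟨N, Z'', j, y, hy, hyd⟩ := hS.exists_trivAlong ξ₂ d
    obtain ⟨N', j', _, _, hj', -⟩ := hS.exists_ses_comp hy hp'
    obtain ⟨M, m, _, q, hm, -, hPm, -⟩ := hS.exists_ses_comp hj' hz
    have hw := hPm.w
    obtain ⟨k', hk'⟩ := hS.exists_lift hE (m ≫ y ≫ g) (by
      have := reassoc_of% hm.zero
      simp only [Category.assoc, hP.w, this, zero_comp])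
    refine ⟨M, Z'', m, (y ≫ p') ≫ z, y ≫ g, k', hm, by simp [hP.w], by simp [hk'], ih ?_⟩
    -- The two ways from `M` to `K₂` differ by `d`, and `ξ₂` is trivial along both terms.
    have hkk : k' ≫ k₀ = q ≫ k - m ≫ y ≫ d := by
      have := hS.mono hE₂
      rw [← cancel_mono i₂]
      simp only [Category.assoc, Preadditive.sub_comp, ← hi, reassoc_of% hk', hd,
        Preadditive.comp_sub, ← hl, ← reassoc_of% hw]
      abel
    rw [hkk]
    exact hS.trivAlong_sub (hS.trivAlong_comp hk q) (hS.trivAlong_comp hyd m)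

lemma trivAlong_iff_of_map {n : ℕ} {X X₂ Y : C} {f : X ⟶ X₂} {ξ : NExtension S n X Y}
    {ξ₂ : NExtension S n X₂ Y} (h : NExtension.Map f ξ ξ₂) {X' : C} (a : X' ⟶ X) :
    ξ.TrivAlong a ↔ ξ₂.TrivAlong (a ≫ f) :=
  ⟨trivAlong_of_map h, hS.trivAlong_of_map_comp h⟩

end IsExactCategory

/-! ### The contravariant functoriality of Yoneda extensions and the connecting maps -/

namespace NExtension

lemma Map.refl {n : ℕ} {X Y : C} (ξ : NExtension S n X Y) : Map (𝟙 X) ξ ξ := by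
  induction ξ with
  | single E i p w hE => exact .single _ (𝟙 E) (by simp) (by simp)
  | splice K E i p w hE ξ ih => exact .splice _ (𝟙 E) (𝟙 K) (by simp) (by simp) ih

lemma Map.comp {n : ℕ} {X X' X'' Y : C} {a : X ⟶ X'} {b : X' ⟶ X''} {ξ : NExtension S n X Y}
    {ξ' : NExtension S n X' Y} {ξ'' : NExtension S n X'' Y} (h : Map a ξ ξ') (h' : Map b ξ' ξ'') :
    Map (a ≫ b) ξ ξ'' := by
  induction h generalizing X'' with
  | single a e hi hp =>
    cases h' with
    | single _ e' hi' hp' =>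
      exact .single _ (e ≫ e') (by rw [reassoc_of% hi, hi'])
        (by rw [Category.assoc, hp', reassoc_of% hp])
  | splice a e k hi hp hξ ih =>
    cases h' with
    | splice _ e' k' hi' hp' hξ' =>
      exact .splice _ (e ≫ e') (k ≫ k') (by rw [reassoc_of% hi, hi', Category.assoc])
        (by rw [Category.assoc, hp', reassoc_of% hp]) (ih hξ')

end NExtension

namespace Ext

/-- The class of an extension. -/
def mk {n : ℕ} {X Y : C} (ξ : NExtension S n X Y) : Ext S n X Y := Quot.mk _ ξ

lemma mk_surjective {n : ℕ} {X Y : C} (x : Ext S n X Y) : ∃ ξ, mk ξ = x := Quot.exists_rep x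

lemma mk_eq {n : ℕ} {X Y : C} {ξ ξ' : NExtension S n X Y} (h : NExtension.Map (𝟙 X) ξ ξ') :
    mk ξ = mk ξ' := Quot.sound h

/-- The connecting map `Extⁿ⁺¹(K, Y) ⟶ Extⁿ⁺²(X, Y)` of a short exact sequence `K ⟶ E ⟶ X`. -/
def splice {n : ℕ} {K E X Y : C} {i : K ⟶ E} {p : E ⟶ X} (h : SES S i p)
    (x : Ext S (n + 1) K Y) : Ext S (n + 2) X Y :=
  Quot.map (NExtension.splice K E i p h.zero h.choose_spec)
    (fun _ _ hξ => .splice _ (𝟙 E) (𝟙 K) (by simp) (by simp) hξ) x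

end Ext

namespace IsExactCategory

open NExtension

variable (hS : IsExactCategory S)
include hS

/-- Pullbacks of extensions exist, and they are terminal: each morphism of extensions factors
through a pullback. This makes the induced maps on classes well defined and functorial. -/
lemma exists_pullback {n : ℕ} {X X' Y : C} (a : X' ⟶ X) (ξ : NExtension S n X Y) :
    ∃ ξ' : NExtension S n X' Y, Map a ξ' ξ ∧
      ∀ ⦃X'' : C⦄ (b : X'' ⟶ X') (ζ : NExtension S n X'' Y), Map (b ≫ a) ζ ξ → Map b ζ ξ' := by
  cases ξ with
  | single E i p w h =>
    obtain ⟨E', i', p', g, h', hP, hg⟩ := hS.exists_ses_pullback ⟨w, h⟩ a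
    refine ⟨.single E' i' p' h'.1 h'.2, .single a g hg hP.w, fun X'' b ζ hζ => ?_⟩
    cases hζ with
    | @single _ _ _ E₁ _ i₁ p₁ w₁ h₁ _ _ _ _ _ e hi hp =>
      have hp : e ≫ p = (p₁ ≫ b) ≫ a := by rw [hp, Category.assoc]
      refine .single b (hP.lift e (p₁ ≫ b) hp) (hP.hom_ext ?_ ?_) (hP.lift_snd _ _ _)
      · rw [Category.assoc, hP.lift_fst, hi, hg]
      · rw [Category.assoc, hP.lift_snd, h'.zero, reassoc_of% w₁, zero_comp]
  | splice K E i p w h ξ =>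
    obtain ⟨E', i', p', g, h', hP, hg⟩ := hS.exists_ses_pullback ⟨w, h⟩ a
    refine ⟨.splice K E' i' p' h'.1 h'.2 ξ, .splice a g (𝟙 K) (by simpa using hg) hP.w (.refl ξ),
      fun X'' b ζ hζ => ?_⟩
    cases hζ with
    | @splice _ _ _ _ K₁ _ E₁ _ i₁ p₁ w₁ h₁ _ _ _ _ ξ₁ _ _ e k hi hp hξ =>
      have hp : e ≫ p = (p₁ ≫ b) ≫ a := by rw [hp, Category.assoc]
      refine .splice b (hP.lift e (p₁ ≫ b) hp) k (hP.hom_ext ?_ ?_) (hP.lift_snd _ _ _) hξ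
      · rw [Category.assoc, hP.lift_fst, hi, Category.assoc, hg]
      · rw [Category.assoc, hP.lift_snd, Category.assoc, h'.zero, reassoc_of% w₁, zero_comp,
          comp_zero]

/-- The map `Extⁿ(X, Y) ⟶ Extⁿ(X', Y)` induced by `a : X' ⟶ X`. -/
noncomputable def pull {n : ℕ} {X X' Y : C} (a : X' ⟶ X) (x : Ext S n X Y) : Ext S n X' Y :=
  Quot.map (fun ξ => (hS.exists_pullback a ξ).choose) (fun ξ ξ' h =>
    (hS.exists_pullback a ξ').choose_spec.2 _ _
      (by simpa using (hS.exists_pullback a ξ).choose_spec.1.comp h)) x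

lemma pull_mk_of_map {n : ℕ} {X X' Y : C} {a : X' ⟶ X} {ξ' : NExtension S n X' Y}
    {ξ : NExtension S n X Y} (h : Map a ξ' ξ) : hS.pull a (.mk ξ) = .mk ξ' :=
  (Ext.mk_eq ((hS.exists_pullback a ξ).choose_spec.2 _ _ (by simpa using h))).symm

lemma pull_id {n : ℕ} {X Y : C} (x : Ext S n X Y) : hS.pull (𝟙 X) x = x := by
  obtain ⟨ξ, rfl⟩ := x.mk_surjective
  exact hS.pull_mk_of_map (.refl ξ)

lemma pull_comp {n : ℕ} {X X' X'' Y : C} (a : X' ⟶ X) (b : X'' ⟶ X') (x : Ext S n X Y) :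
    hS.pull (b ≫ a) x = hS.pull b (hS.pull a x) := by
  obtain ⟨ξ, rfl⟩ := x.mk_surjective
  obtain ⟨ξ', h, -⟩ := hS.exists_pullback a ξ
  obtain ⟨ξ'', h', -⟩ := hS.exists_pullback b ξ'
  rw [hS.pull_mk_of_map h, hS.pull_mk_of_map h', hS.pull_mk_of_map (h'.comp h)]

/-- The naturality of the connecting maps. -/
lemma splice_pull {n : ℕ} {K E X K' E' X' Y : C} {i : K ⟶ E} {p : E ⟶ X} {i' : K' ⟶ E'}
    {p' : E' ⟶ X'} (h : SES S i p) (h' : SES S i' p') {k : K ⟶ K'} {e : E ⟶ E'} {a : X ⟶ X'}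
    (hi : i ≫ e = k ≫ i') (hp : e ≫ p' = p ≫ a) (x : Ext S (n + 1) K' Y) :
    Ext.splice h (hS.pull k x) = hS.pull a (Ext.splice h' x) := by
  obtain ⟨ξ, rfl⟩ := x.mk_surjective
  obtain ⟨ξ', hξ, -⟩ := hS.exists_pullback k ξ
  rw [hS.pull_mk_of_map hξ]
  exact (hS.pull_mk_of_map (.splice a e k hi hp hξ)).symm

/-- The naturality of the connecting maps, for morphisms of short exact sequences with the same
end. -/
lemma splice_pull_of_eq {n : ℕ} {K E X K' E' Y : C} {i : K ⟶ E} {p : E ⟶ X} {i' : K' ⟶ E'}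
    {p' : E' ⟶ X} (h : SES S i p) (h' : SES S i' p') {k : K ⟶ K'} {e : E ⟶ E'}
    (hi : i ≫ e = k ≫ i') (hp : e ≫ p' = p) (x : Ext S (n + 1) K' Y) :
    Ext.splice h (hS.pull k x) = Ext.splice h' x := by
  rw [hS.splice_pull h h' hi (a := 𝟙 X) (by simpa using hp), hS.pull_id]

/-! ### Vanishing of extension classes -/

/-- The class `x` becomes trivial along `a`; this does not depend on the representative. -/
def Triv {n : ℕ} {X Y : C} (x : Ext S n X Y) {X' : C} (a : X' ⟶ X) : Prop :=
  Quot.lift (fun ξ => ξ.TrivAlong a)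
    (fun _ _ h => propext (by simpa using hS.trivAlong_iff_of_map h a)) x

lemma triv_mk {n : ℕ} {X Y X' : C} (ξ : NExtension S n X Y)
    (a : X' ⟶ X) : hS.Triv (.mk ξ) a ↔ ξ.TrivAlong a := Iff.rfl

lemma triv_pull {n : ℕ} {X Y X' X'' : C} {x : Ext S n X Y} {a : X' ⟶ X} {b : X'' ⟶ X'} :
    hS.Triv (hS.pull a x) b ↔ hS.Triv x (b ≫ a) := by
  obtain ⟨ξ, rfl⟩ := x.mk_surjective
  obtain ⟨ξ', hξ, -⟩ := hS.exists_pullback a ξ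
  rw [hS.pull_mk_of_map hξ]
  exact hS.trivAlong_iff_of_map hξ b

lemma triv_of_id {n : ℕ} {X Y : C} {x : Ext S n X Y} (h : hS.Triv x (𝟙 X)) {X' : C}
    (a : X' ⟶ X) : hS.Triv x a := by
  obtain ⟨ξ, rfl⟩ := x.mk_surjective
  exact hS.trivAlong_of_id h a

lemma triv_splice {n : ℕ} {K E X Y : C} {i : K ⟶ E} {p : E ⟶ X} (h : SES S i p)
    {x : Ext S (n + 1) K Y} (hx : hS.Triv x (𝟙 K)) : hS.Triv (Ext.splice h x) (𝟙 X) := by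
  obtain ⟨ξ, rfl⟩ := x.mk_surjective
  exact ⟨K, E, i, p, 𝟙 E, 𝟙 K, h, by simp, by simp, hx⟩

/-- Any two extensions which become trivial have the same pullback: the trivializations are compared
on a common refinement, and short exact sequences with a section are all isomorphic. -/
lemma pull_eq_pull_of_trivAlong {n : ℕ} {X X₁ X₂ Y : C} (ξ₁ : NExtension S n X₁ Y)
    (ξ₂ : NExtension S n X₂ Y) {a₁ : X ⟶ X₁} {a₂ : X ⟶ X₂} (h₁ : ξ₁.TrivAlong a₁)
    (h₂ : ξ₂.TrivAlong a₂) : hS.pull a₁ (.mk ξ₁) = hS.pull a₂ (.mk ξ₂) := by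
  induction ξ₁ generalizing X X₂ with
  | @single X₁ Y E₁ i₁ p₁ w₁ hE₁ =>
    cases ξ₂ with
    | single E₂ i₂ p₂ w₂ hE₂ =>
      obtain ⟨s₁, hs₁⟩ := h₁
      obtain ⟨s₂, hs₂⟩ := h₂
      obtain ⟨P, i, p, s, r, hP, hsp, hir, hsr⟩ := hS.exists_ses_split Y X
      have h : ∀ {X' E : C} {j : Y ⟶ E} {q : E ⟶ X'} (w : j ≫ q = 0)
          (hE : S (ShortComplex.mk j q w)) (t : X ⟶ E), hS.pull (t ≫ q) (.mk (.single E j q w hE)) =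
            .mk (.single P i p hP.1 hP.2) := fun {X' E j q} w hE t =>
        hS.pull_mk_of_map (.single _ (r ≫ j + p ≫ t)
          (by simp [reassoc_of% hir, reassoc_of% hP.zero]) (by simp [w]))
      rw [← hs₁, ← hs₂]
      exact (h w₁ hE₁ s₁).trans (h w₂ hE₂ s₂).symm
  | @splice n X₁ Y K₁ E₁ i₁ p₁ w₁ hE₁ ξ₁ ih =>
    cases ξ₂ with
    | splice K₂ E₂ i₂ p₂ w₂ hE₂ ξ₂ =>
      obtain ⟨L₁, Z₁, l₁, z₁, e₁, k₁, hz₁, he₁, hl₁, hk₁⟩ := h₁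
      obtain ⟨L₂, Z₂, l₂, z₂, e₂, k₂, hz₂, he₂, hl₂, hk₂⟩ := h₂
      obtain ⟨L, Z, l, z, g₁, g₂, q₁, q₂, hz, hg₁, hg₂, hq₁, hq₂⟩ :=
        hS.exists_common_refinement hz₁ hz₂
      have h₁' := hS.splice_pull hz ⟨w₁, hE₁⟩ (k := q₁ ≫ k₁) (e := g₁ ≫ e₁) (a := a₁)
        (by rw [reassoc_of% hq₁, hl₁, Category.assoc])
        (by rw [Category.assoc, he₁, reassoc_of% hg₁]) (.mk ξ₁)
      have h₂' := hS.splice_pull hz ⟨w₂, hE₂⟩ (k := q₂ ≫ k₂) (e := g₂ ≫ e₂) (a := a₂)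
        (by rw [reassoc_of% hq₂, hl₂, Category.assoc])
        (by rw [Category.assoc, he₂, reassoc_of% hg₂]) (.mk ξ₂)
      rw [ih ξ₂ (hS.trivAlong_comp hk₁ q₁) (hS.trivAlong_comp hk₂ q₂)] at h₁'
      exact h₁'.symm.trans h₂'

lemma nonempty_nExtension (n : ℕ) (X Y : C) : Nonempty (NExtension S (n + 1) X Y) := by
  induction n generalizing X with
  | zero =>
    obtain ⟨P, i, p, s, r, hP, -⟩ := hS.exists_ses_split Y X
    exact ⟨.single P i p hP.1 hP.2⟩
  | succ n ih =>
    obtain ⟨O, hO, h⟩ := hS.exists_ses_id X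
    obtain ⟨ξ⟩ := ih O
    exact ⟨.splice O X 0 (𝟙 X) h.1 h.2 ξ⟩

/-- A group `Extⁿ⁺¹(X, Y)` vanishes if and only if all its classes are trivial. -/
lemma subsingleton_ext_iff {n : ℕ} {X Y : C} :
    Subsingleton (Ext S (n + 1) X Y) ↔
      ∀ ξ : NExtension S (n + 1) X Y, ξ.TrivAlong (𝟙 X) := by
  constructor
  · intro h ξ
    obtain ⟨ξ₀⟩ := hS.nonempty_nExtension n X Y
    obtain ⟨ξ', hξ', -⟩ := hS.exists_pullback (0 : X ⟶ X) ξ₀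
    rw [← hS.triv_mk, Subsingleton.elim (Ext.mk ξ) (Ext.mk ξ'), hS.triv_mk,
      hS.trivAlong_iff_of_map hξ', comp_zero]
    exact hS.trivAlong_zero ξ₀ X
  · refine fun h => ⟨fun x y => ?_⟩
    obtain ⟨ξ, rfl⟩ := x.mk_surjective
    obtain ⟨ξ', rfl⟩ := y.mk_surjective
    simpa only [hS.pull_id] using hS.pull_eq_pull_of_trivAlong ξ ξ' (h ξ) (h ξ')

lemma subsingleton_ext_iff_triv {n : ℕ} {X Y : C} :
    Subsingleton (Ext S (n + 1) X Y) ↔ ∀ x : Ext S (n + 1) X Y, hS.Triv x (𝟙 X) := by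
  rw [hS.subsingleton_ext_iff]
  refine ⟨fun h x => ?_, fun h ξ => h (.mk ξ)⟩
  obtain ⟨ξ, rfl⟩ := x.mk_surjective
  exact h ξ

lemma triv_of_subsingleton {n : ℕ} {X Y : C} (h : Subsingleton (Ext S (n + 1) X Y))
    (x : Ext S (n + 1) X Y) {X' : C} (a : X' ⟶ X) : hS.Triv x a :=
  hS.triv_of_id (hS.subsingleton_ext_iff_triv.1 h x) a

lemma subsingleton_ext_of_retract {n : ℕ} {X X' Y : C} (r : Retract X X')
    (h : Subsingleton (Ext S n X' Y)) : Subsingleton (Ext S n X Y) := by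
  refine ⟨fun x y => ?_⟩
  rw [← hS.pull_id x, ← hS.pull_id y, ← r.retract, hS.pull_comp, hS.pull_comp,
    Subsingleton.elim (hS.pull r.r x) (hS.pull r.r y)]

end IsExactCategory

/-! ### The long exact sequence in the first variable -/

namespace IsExactCategory

open NExtension

variable (hS : IsExactCategory S)
include hS

/-- Given a morphism from a short exact sequence `L ⟶ Z ⟶ X` to `K ⟶ E ⟶ X` and a deflation
`U ⟶ K` with kernel `A`, there is a deflation `V ⟶ E` through which `U ⟶ K ⟶ E` factors and whose
kernel `M` is the pullback of `U ⟶ K` along the negative of `L ⟶ K`. Namely, `E` is a quotient of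
`P = Z ×_X E`, and `V` is the pullback of `U` along the retraction of `P` onto `K`. -/
lemma exists_deflation_extending {K E X L Z A U : C} {i : K ⟶ E} {p : E ⟶ X} {l : L ⟶ Z}
    {z : Z ⟶ X} {a : A ⟶ U} {u : U ⟶ K} (h : SES S i p) (hz : SES S l z) (hu : SES S a u)
    {e : Z ⟶ E} {k : L ⟶ K} (he : e ≫ p = z) (hl : l ≫ e = k ≫ i) :
    ∃ (V M : C) (m : M ⟶ V) (v : V ⟶ E) (j : A ⟶ M) (q : M ⟶ L) (f : U ⟶ V) (g : M ⟶ U),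
      SES S m v ∧ SES S j q ∧ f ≫ v = u ≫ i ∧ a ≫ f = j ≫ m ∧ j ≫ g = a ∧ g ≫ u = q ≫ (-k) := by
  have := hS.mono h
  have := hS.mono hz
  obtain ⟨P, l', g₂, g₁, hg₂, hP, hl'⟩ := hS.exists_ses_pullback hz p
  obtain ⟨r, hr⟩ := hS.exists_lift h (g₂ - g₁ ≫ e) (by simp [he, hP.w])
  obtain ⟨V, a', v, w, hv, hV, ha'⟩ := hS.exists_ses_pullback hu r
  obtain ⟨M, m, j, q, hm, hj, hM, hjm⟩ := hS.exists_ses_comp hv hg₂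
  have hlr : l' ≫ r = -k := by
    rw [← cancel_mono i]
    simp [hr, hg₂.zero, reassoc_of% hl', hl]
  have hi₁ : hP.lift 0 i (by simp [h.zero]) ≫ g₁ = 0 := hP.lift_fst _ _ _
  have hi₂ : hP.lift 0 i (by simp [h.zero]) ≫ g₂ = i := hP.lift_snd _ _ _
  have hir : hP.lift 0 i (by simp [h.zero]) ≫ r = 𝟙 K := by
    rw [← cancel_mono i]
    simp [hr, hi₂, reassoc_of% hi₁]
  refine ⟨V, M, m, v ≫ g₂, j, q, hV.lift (𝟙 U) (u ≫ hP.lift 0 i (by simp [h.zero]))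
    (by simp [hir]), m ≫ w, hm, hj, ?_, ?_, ?_, ?_⟩
  · rw [← Category.assoc, hV.lift_snd, Category.assoc, hi₂]
  · apply hV.hom_ext
    · rw [Category.assoc, hV.lift_fst, hjm, ha', Category.comp_id]
    · rw [Category.assoc, hV.lift_snd, hjm, hv.zero, reassoc_of% hu.zero, zero_comp]
  · rw [reassoc_of% hjm, ha']
  · rw [Category.assoc, hV.w, reassoc_of% hM.w, hlr]

/-- Exactness at `Ext(K, Y)` for a short exact sequence `K ⟶ E ⟶ X`. -/
lemma exists_pull_eq_of_triv_splice {n : ℕ} {K E X Y : C} {i : K ⟶ E} {p : E ⟶ X} (h : SES S i p)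
    (x : Ext S (n + 1) K Y) (hx : hS.Triv (Ext.splice h x) (𝟙 X)) :
    ∃ y : Ext S (n + 1) E Y, hS.pull i y = x := by
  obtain ⟨ξ, rfl⟩ := x.mk_surjective
  induction n generalizing K E X with
  | zero =>
    obtain ⟨L, Z, l, z, e, k, hz, he, hl, hk⟩ := hx
    rw [Category.comp_id] at he
    cases ξ with
    | single U a u w hu =>
      obtain ⟨V, M, m, v, j, q, f, g, hm, hj, hf, ha, hg, hgu⟩ :=
        hS.exists_deflation_extending h hz ⟨w, hu⟩ he hl
      have hT : (NExtension.single M j q hj.1 hj.2).TrivAlong (𝟙 L) := by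
        rw [hS.trivAlong_iff_of_map (ξ₂ := .single U a u w hu) (.single (-k) g hg hgu),
          Category.id_comp]
        exact hS.trivAlong_neg hk
      obtain ⟨s, hs⟩ := hT
      obtain ⟨r, hr, -⟩ := hS.exists_retraction hj s hs
      obtain ⟨W, i', p', t, hp', hW, ht⟩ := hS.exists_ses_pushout hm r
      refine ⟨.mk (.single W i' p' hp'.1 hp'.2), hS.pull_mk_of_map (.single i (f ≫ t) ?_ ?_)⟩
      · rw [reassoc_of% ha, hW.w, reassoc_of% hr]
      · rw [Category.assoc, ht, hf]
  | succ n ih =>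
    obtain ⟨L, Z, l, z, e, k, hz, he, hl, hk⟩ := hx
    rw [Category.comp_id] at he
    cases ξ with
    | splice A U a u w hu ξ =>
      obtain ⟨V, M, m, v, j, q, f, g, hm, hj, hf, ha, hg, hgu⟩ :=
        hS.exists_deflation_extending h hz ⟨w, hu⟩ he hl
      have hT : (NExtension.splice A M j q hj.1 hj.2 ξ).TrivAlong (𝟙 L) := by
        rw [hS.trivAlong_iff_of_map (ξ₂ := .splice A U a u w hu ξ)
          (.splice (-k) g (𝟙 A) (by simpa using hg) hgu (.refl ξ)), Category.id_comp]
        exact hS.trivAlong_neg hk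
      obtain ⟨y, hy⟩ := ih hj ξ hT
      refine ⟨Ext.splice hm y, ?_⟩
      rw [← hS.splice_pull ⟨w, hu⟩ hm ha hf, hy]
      rfl

/-- Exactness at `Ext(E, Y)` for a short exact sequence `K ⟶ E ⟶ X`. -/
lemma exists_pull_eq_of_triv {n : ℕ} {K E X Y : C} {i : K ⟶ E} {p : E ⟶ X} (h : SES S i p)
    (x : Ext S (n + 1) E Y) (hx : hS.Triv x i) :
    ∃ y : Ext S (n + 1) X Y, hS.pull p y = x := by
  obtain ⟨ξ, rfl⟩ := x.mk_surjective
  rw [hS.triv_mk] at hx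
  cases ξ with
  | single U a u w hu =>
    obtain ⟨M, m, j, q, hm, hj, hM, hjm⟩ := hS.exists_ses_comp ⟨w, hu⟩ h
    have hT : (NExtension.single M j q hj.1 hj.2).TrivAlong (𝟙 K) := by
      rwa [hS.trivAlong_iff_of_map (ξ₂ := .single U a u w hu) (.single i m hjm hM.w),
        Category.id_comp]
    obtain ⟨s, hs⟩ := hT
    obtain ⟨r, hr, -⟩ := hS.exists_retraction hj s hs
    obtain ⟨W, i', p', t, hp', hW, ht⟩ := hS.exists_ses_pushout hm r
    refine ⟨.mk (.single W i' p' hp'.1 hp'.2), hS.pull_mk_of_map (.single p t ?_ ht)⟩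
    rw [← hjm, Category.assoc, hW.w, reassoc_of% hr]
  | splice A U a u w hu ξ =>
    obtain ⟨M, m, j, q, hm, hj, hM, hjm⟩ := hS.exists_ses_comp ⟨w, hu⟩ h
    have hT : (NExtension.splice A M j q hj.1 hj.2 ξ).TrivAlong (𝟙 K) := by
      rwa [hS.trivAlong_iff_of_map (ξ₂ := .splice A U a u w hu ξ)
        (.splice i m (𝟙 A) (by simpa using hjm) hM.w (.refl ξ)), Category.id_comp]
    obtain ⟨y, hy⟩ := hS.exists_pull_eq_of_triv_splice hj (.mk ξ) hT
    refine ⟨Ext.splice hm y, ?_⟩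
    rw [← hS.splice_pull ⟨w, hu⟩ hm (k := j) (e := 𝟙 U) (by simpa using hjm.symm) (by simp), hy]
    rfl

/-- Exactness at `Ext(X, Y)` for a short exact sequence `K ⟶ E ⟶ X`. -/
lemma exists_splice_eq_of_triv {n : ℕ} {K E X Y : C} {i : K ⟶ E} {p : E ⟶ X} (h : SES S i p)
    (x : Ext S (n + 2) X Y) (hx : hS.Triv x p) :
    ∃ y : Ext S (n + 1) K Y, Ext.splice h y = x := by
  obtain ⟨ξ, rfl⟩ := x.mk_surjective
  cases ξ with
  | splice A U a u w hu ξ =>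
    obtain ⟨L, Z, l, z, e, k, hz, he, hl, hk⟩ := hx
    obtain ⟨M, m, j, q, hm, hj, hM, hjm⟩ := hS.exists_ses_comp hz h
    obtain ⟨k', hk'⟩ := hS.exists_kernel_map hm ⟨w, hu⟩ e (𝟙 X) (by simp [he])
    have hjk : j ≫ k' = k := by
      have := hS.mono ⟨w, hu⟩
      rw [← cancel_mono a, Category.assoc, hk', reassoc_of% hjm, hl]
    obtain ⟨y, hy⟩ := hS.exists_pull_eq_of_triv hj (hS.pull k' (.mk ξ))
      (by rwa [hS.triv_pull, hjk])
    refine ⟨y, ?_⟩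
    rw [← hS.splice_pull_of_eq hm h hM.w rfl, hy,
      hS.splice_pull_of_eq hm ⟨w, hu⟩ hk'.symm (by rw [he])]
    rfl

/-! ### Dimension shifting in the first variable -/

lemma subsingleton_ext_middle {n : ℕ} {K E X Y : C} {i : K ⟶ E} {p : E ⟶ X} (h : SES S i p)
    (hK : Subsingleton (Ext S (n + 1) K Y)) (hX : Subsingleton (Ext S (n + 1) X Y)) :
    Subsingleton (Ext S (n + 1) E Y) := by
  rw [hS.subsingleton_ext_iff_triv]
  intro x
  obtain ⟨y, rfl⟩ := hS.exists_pull_eq_of_triv h x (by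
    simpa [hS.triv_pull] using hS.triv_of_subsingleton hK (hS.pull i x) (𝟙 K))
  rw [hS.triv_pull]
  exact hS.triv_of_subsingleton hX y _

lemma subsingleton_ext_right {n : ℕ} {K E X Y : C} {i : K ⟶ E} {p : E ⟶ X} (h : SES S i p)
    (hK : Subsingleton (Ext S (n + 1) K Y)) (hE : Subsingleton (Ext S (n + 2) E Y)) :
    Subsingleton (Ext S (n + 2) X Y) := by
  rw [hS.subsingleton_ext_iff_triv]
  intro x
  obtain ⟨y, rfl⟩ := hS.exists_splice_eq_of_triv h x (by
    simpa [hS.triv_pull] using hS.triv_of_subsingleton hE (hS.pull p x) (𝟙 E))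
  exact hS.triv_splice h (hS.triv_of_subsingleton hK y _)

lemma subsingleton_ext_left {n : ℕ} {K E X Y : C} {i : K ⟶ E} {p : E ⟶ X} (h : SES S i p)
    (hE : Subsingleton (Ext S (n + 1) E Y)) (hX : Subsingleton (Ext S (n + 2) X Y)) :
    Subsingleton (Ext S (n + 1) K Y) := by
  rw [hS.subsingleton_ext_iff_triv]
  intro x
  obtain ⟨y, rfl⟩ := hS.exists_pull_eq_of_triv_splice h x (hS.triv_of_subsingleton hX _ _)
  rw [hS.triv_pull]
  exact hS.triv_of_subsingleton hE y _

end IsExactCategory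

/-! ### Dimension shifting in the second variable -/

namespace IsExactCategory

open NExtension

variable (hS : IsExactCategory S)
include hS

lemma exists_ses_of_isPushout {K E X K' E' : C} {i : K ⟶ E} {p : E ⟶ X} (h : SES S i p)
    {a : K ⟶ K'} {g : E ⟶ E'} {i' : K' ⟶ E'} (hP : IsPushout i a g i') :
    ∃ p' : E' ⟶ X, SES S i' p' ∧ g ≫ p' = p := by
  obtain ⟨E'', i'', p'', g'', h'', hP'', hg⟩ := hS.exists_ses_pushout h a
  have hi := IsPushout.inr_isoIsPushout_hom _ _ hP hP''
  have hg' := IsPushout.inl_isoIsPushout_hom _ _ hP hP''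
  refine ⟨(hP.isoIsPushout _ _ hP'').hom ≫ p'', hS.ses_of_iso h'' (Iso.refl _)
    (hP.isoIsPushout _ _ hP'').symm (Iso.refl _) ?_ (by simp), ?_⟩
  · rw [Iso.refl_hom, Category.id_comp, Iso.symm_hom, Iso.eq_comp_inv, hi]
  · rw [reassoc_of% hg', hg]

/-- An extension of length at least two is a Yoneda product with a short exact sequence, and so it
is trivial wherever the other factor is. -/
lemma exists_trivAlong_imp {n : ℕ} {X Y : C} (ξ : NExtension S (n + 2) X Y) :
    ∃ (Q : C) (ζ : NExtension S (n + 1) X Q), ∀ ⦃X' : C⦄ (b : X' ⟶ X),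
      ζ.TrivAlong b → ξ.TrivAlong b := by
  induction n generalizing X with
  | zero =>
    cases ξ with
    | splice K E i p w h ξ =>
      refine ⟨K, .single E i p w h, fun X' b ⟨s, hs⟩ => ?_⟩
      obtain ⟨O, hO, h⟩ := hS.exists_ses_id X'
      exact ⟨O, X', 0, 𝟙 X', s, 0, h, by simp [hs], by simp, hS.trivAlong_zero _ _⟩
  | succ n ih =>
    cases ξ with
    | splice K E i p w h ξ =>
      obtain ⟨Q, ζ, hζ⟩ := ih ξ
      exact ⟨Q, .splice K E i p w h ζ, fun X' b ⟨L, Z, l, z, e, k, hz, he, hl, hk⟩ =>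
        ⟨L, Z, l, z, e, k, hz, he, hl, hζ k hk⟩⟩

/-- The pushout of `L ⟶ Z ⟶ X` along a map `L ⟶ N`, which is to be lifted through a deflation
`W ⟶ N`: wherever the pushout splits, such a lift exists after passing to another deflation. -/
lemma exists_lift_of_trivAlong {L Z X Y W N : C} {l : L ⟶ Z} {z : Z ⟶ X} {d : Y ⟶ W} {c : W ⟶ N}
    (hz : SES S l z) (hd : SES S d c) (f : L ⟶ N) :
    ∃ ζ : NExtension S 1 X N, ∀ ⦃X' : C⦄ (b : X' ⟶ X), ζ.TrivAlong b →
      ∃ (M Z' : C) (m : M ⟶ Z') (z' : Z' ⟶ X') (g : Z' ⟶ Z) (q : M ⟶ L) (x : M ⟶ W),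
        SES S m z' ∧ g ≫ z = z' ≫ b ∧ m ≫ g = q ≫ l ∧ x ≫ c = q ≫ f := by
  obtain ⟨E, i, p, gE, hp, hP, hgE⟩ := hS.exists_ses_pushout hz f
  refine ⟨.single E i p hp.1 hp.2, fun X' b ⟨t, ht⟩ => ?_⟩
  obtain ⟨Zb, lb, zb, gb, hzb, hPb, hgb⟩ := hS.exists_ses_pullback hz b
  obtain ⟨σ, hσ⟩ := hS.exists_lift hp (gb ≫ gE - zb ≫ t) (by simp [hgE, ht, hPb.w])
  have hlσ : lb ≫ σ = f := by
    have := hS.mono hp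
    rw [← cancel_mono i]
    simp [hσ, reassoc_of% hgb, reassoc_of% hzb.zero, hP.w]
  obtain ⟨Z', d', y, w, hy, hPy, -⟩ := hS.exists_ses_pullback hd σ
  obtain ⟨M, m, j, q, hm, -, hM, -⟩ := hS.exists_ses_comp hy hzb
  refine ⟨M, Z', m, y ≫ zb, y ≫ gb, q, m ≫ w, hm, by simp [hPb.w], ?_, ?_⟩
  · rw [reassoc_of% hM.w, hgb]
  · rw [Category.assoc, hPy.w, reassoc_of% hM.w, hlσ]

/-- Given enough objects of `𝒳`, each extension of length at least two is the image of an extension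
by the cokernel of an inflation into an object of `𝒳`, under the connecting map in the second
variable. -/
lemma exists_cosyzygy_trivAlong_imp {𝒳 : ObjectProperty C}
    (h𝒳 : ∀ M : C, ∃ (X₀ : C) (i : M ⟶ X₀), 𝒳 X₀ ∧ IsInflation S i) {n : ℕ} {X Y : C}
    (ξ : NExtension S (n + 2) X Y) :
    ∃ (W N : C) (d : Y ⟶ W) (c : W ⟶ N) (ζ : NExtension S (n + 1) X N), SES S d c ∧ 𝒳 W ∧
      ∀ ⦃X' : C⦄ (b : X' ⟶ X), ζ.TrivAlong b → ξ.TrivAlong b := by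
  induction n generalizing X with
  | zero =>
    cases ξ with
    | splice K E i p w h ξ =>
      cases ξ with
      | single U a u w' hu =>
        obtain ⟨W, f, hW, N', g, hf⟩ := h𝒳 U
        have hf : SES S f g := hf
        obtain ⟨N, c, j, q, hc, hj, hP, hcq⟩ := hS.exists_ses_comp' ⟨w', hu⟩ hf
        obtain ⟨ζ, hζ⟩ := hS.exists_lift_of_trivAlong ⟨w, h⟩ hc j
        refine ⟨W, N, a ≫ f, c, ζ, hc, hW, fun X' b hb => ?_⟩
        obtain ⟨M, Z', m, z', g', q', x, hm, hg', hmg, hx⟩ := hζ b hb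
        obtain ⟨y, rfl⟩ := hS.exists_lift hf x (by
          rw [← hcq, reassoc_of% hx, hj.zero, comp_zero])
        refine ⟨M, Z', m, z', g', q', hm, hg', hmg, y, ?_⟩
        have := hS.mono hj
        rw [← cancel_mono j, Category.assoc, ← hP.w, ← hx, Category.assoc]
  | succ n ih =>
    cases ξ with
    | splice K E i p w h ξ =>
      obtain ⟨W, N, d, c, ζ, hd, hW, hζ⟩ := ih ξ
      exact ⟨W, N, d, c, .splice K E i p w h ζ, hd, hW,
        fun X' b ⟨L, Z, l, z, e, k, hz, he, hl, hk⟩ => ⟨L, Z, l, z, e, k, hz, he, hl, hζ k hk⟩⟩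

/-- Exactness at `Extⁿ⁺²(X, Y)` for a short exact sequence `Y ⟶ W ⟶ N`: if the pushforward `ξW` of
`ξ` along `Y ⟶ W` becomes trivial along `a`, then the pullback of `ξ` along `a` is the image of
some `ζ` under the connecting map. -/
lemma exists_pushforward_of_ses {Y W N : C} {d : Y ⟶ W} {c : W ⟶ N} (hd : SES S d c) {n : ℕ}
    {X : C} (ξ : NExtension S (n + 2) X Y) :
    ∃ ξW : NExtension S (n + 2) X W, ∀ ⦃X' : C⦄ (a : X' ⟶ X), ξW.TrivAlong a →
      ∃ ζ : NExtension S (n + 1) X' N, ∀ ⦃X'' : C⦄ (b : X'' ⟶ X'), ζ.TrivAlong b →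
        ξ.TrivAlong (b ≫ a) := by
  induction n generalizing X with
  | zero =>
    cases ξ with
    | splice K E i p w h ξ =>
      cases ξ with
      | single U a u w' hu =>
        obtain ⟨U', i', u', g, hu', hP, hgu'⟩ := hS.exists_ses_pushout ⟨w', hu⟩ d
        obtain ⟨ρ, hρ, hiρ⟩ := hS.exists_ses_of_isPushout hd hP.flip
        refine ⟨.splice K E i p w h (.single U' i' u' hu'.1 hu'.2), fun X' a' ha' => ?_⟩
        obtain ⟨L, Z, l, z, e, k, hz, he, hl, s, hs⟩ := ha'
        obtain ⟨ζ, hζ⟩ := hS.exists_lift_of_trivAlong hz hd (s ≫ ρ)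
        refine ⟨ζ, fun X'' b hb => ?_⟩
        obtain ⟨M, Z', m, z', g', q', x, hm, hg', hmg, hx⟩ := hζ b hb
        obtain ⟨y, hy⟩ := hS.exists_lift hρ (q' ≫ s - x ≫ i') (by simp [hiρ, hx])
        refine ⟨M, Z', m, z', g' ≫ e, q' ≫ k, hm, by rw [Category.assoc, he, reassoc_of% hg'],
          by rw [reassoc_of% hmg, hl, Category.assoc], y, ?_⟩
        rw [← hgu', reassoc_of% hy]
        simp [hu'.zero, hs]
  | succ n ih =>
    cases ξ with
    | splice K E i p w h ξ =>
      obtain ⟨ξW, hξW⟩ := ih ξ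
      refine ⟨.splice K E i p w h ξW, fun X' a' ha' => ?_⟩
      obtain ⟨L, Z, l, z, e, k, hz, he, hl, hk⟩ := ha'
      obtain ⟨ζ, hζ⟩ := hξW k hk
      refine ⟨.splice L Z l z hz.1 hz.2 ζ, fun X'' b hb => ?_⟩
      obtain ⟨L', Z', l', z', e', k', hz', he', hl', hk'⟩ := hb
      exact ⟨L', Z', l', z', e' ≫ e, k' ≫ k, hz', by rw [Category.assoc, he, reassoc_of% he'],
        by rw [reassoc_of% hl', hl, Category.assoc], hζ k' hk'⟩

/-- The pushforward along a split monomorphism detects trivial extensions. -/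
lemma exists_pushforward_of_retract {Y W : C} (r : Retract Y W) {n : ℕ} {X : C}
    (ξ : NExtension S n X Y) :
    ∃ ξW : NExtension S n X W, ∀ ⦃X' : C⦄ (a : X' ⟶ X), ξW.TrivAlong a → ξ.TrivAlong a := by
  induction ξ with
  | single U a u w hu =>
    obtain ⟨U', i', u', g, hu', hP, hgu'⟩ := hS.exists_ses_pushout ⟨w, hu⟩ r.i
    refine ⟨.single U' i' u' hu'.1 hu'.2, fun X' a' ⟨s, hs⟩ =>
      ⟨s ≫ hP.desc (𝟙 U) (r.r ≫ a) (by simp), ?_⟩⟩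
    rw [← hs, Category.assoc]
    congr 1
    apply hP.hom_ext
    · simp [hgu']
    · simp [hu'.zero, w]
  | splice K E i p w h ξ ih =>
    obtain ⟨ξW, hξW⟩ := ih r
    exact ⟨.splice K E i p w h ξW, fun X' b ⟨L, Z, l, z, e, k, hz, he, hl, hk⟩ =>
      ⟨L, Z, l, z, e, k, hz, he, hl, hξW k hk⟩⟩

lemma subsingleton_ext_succ {n : ℕ} {X : C} (h : ∀ Y : C, Subsingleton (Ext S (n + 1) X Y))
    (Y : C) : Subsingleton (Ext S (n + 2) X Y) := by
  rw [hS.subsingleton_ext_iff]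
  intro ξ
  obtain ⟨Q, ζ, hζ⟩ := hS.exists_trivAlong_imp ξ
  exact hζ _ (hS.subsingleton_ext_iff.1 (h Q) ζ)

lemma subsingleton_ext_of_ses_right {n : ℕ} {X Y W N : C} {d : Y ⟶ W} {c : W ⟶ N}
    (hd : SES S d c) (hN : Subsingleton (Ext S (n + 1) X N))
    (hW : Subsingleton (Ext S (n + 2) X W)) : Subsingleton (Ext S (n + 2) X Y) := by
  rw [hS.subsingleton_ext_iff]
  intro ξ
  obtain ⟨ξW, hξW⟩ := hS.exists_pushforward_of_ses hd ξ
  obtain ⟨ζ, hζ⟩ := hξW (𝟙 X) (hS.subsingleton_ext_iff.1 hW ξW)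
  simpa using hζ _ (hS.subsingleton_ext_iff.1 hN ζ)

lemma subsingleton_ext_of_retract_right {n : ℕ} {X Y W : C} (r : Retract Y W)
    (hW : Subsingleton (Ext S (n + 1) X W)) : Subsingleton (Ext S (n + 1) X Y) := by
  rw [hS.subsingleton_ext_iff]
  intro ξ
  obtain ⟨ξW, hξW⟩ := hS.exists_pushforward_of_retract r ξ
  exact hξW _ (hS.subsingleton_ext_iff.1 hW ξW)

/-- Over a coresolving subcategory, the vanishing of `Ext¹(X, -)` implies the vanishing of all
higher `Extⁱ(X, -)`. -/
lemma subsingleton_ext_of_isCoresolving {𝒳 : ObjectProperty C} (h𝒳 : IsCoresolving S 𝒳) {X : C}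
    (h : ∀ M : C, 𝒳 M → Subsingleton (Ext S 1 X M)) (n : ℕ) {M : C} (hM : 𝒳 M) :
    Subsingleton (Ext S (n + 1) X M) := by
  induction n generalizing M with
  | zero => exact h M hM
  | succ n ih =>
    rw [hS.subsingleton_ext_iff]
    intro ξ
    obtain ⟨W, N, d, c, ζ, hd, hW, hζ⟩ := hS.exists_cosyzygy_trivAlong_imp h𝒳.cogenerating ξ
    exact hζ _ (hS.subsingleton_ext_iff.1 (ih (h𝒳.inflationClosed _ hd.choose_spec hM hW)) ζ)

end IsExactCategory

/-! ### Objects of finite projective dimension -/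

namespace IsExactCategory

variable (hS : IsExactCategory S)
include hS

lemma projDimLE_mono {X : C} {m n : ℕ} (hmn : m ≤ n) (h : ProjDimLE S m X) : ProjDimLE S n X := by
  induction n, hmn using Nat.le_induction with
  | base => exact h
  | succ n _ ih => exact fun Y => hS.subsingleton_ext_succ ih Y

lemma isThick_finiteProjDim : IsThick S (finiteProjDim S) where
  summands := ⟨fun r ⟨n, hn⟩ => ⟨n, fun Y => hS.subsingleton_ext_of_retract r (hn Y)⟩⟩
  extensionClosed := by
    rintro c hc ⟨m, hm⟩ ⟨n, hn⟩
    have hm := hS.projDimLE_mono (le_max_left m n) hm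
    have hn := hS.projDimLE_mono (le_max_right m n) hn
    exact ⟨max m n, fun Y => hS.subsingleton_ext_middle ⟨c.zero, hc⟩ (hm Y) (hn Y)⟩
  inflationClosed := by
    rintro c hc ⟨m, hm⟩ ⟨n, hn⟩
    have hm := hS.projDimLE_mono (le_max_left m n) hm
    have hn := hS.projDimLE_mono ((le_max_right m n).trans (Nat.le_succ _)) hn
    exact ⟨max m n + 1, fun Y => hS.subsingleton_ext_right ⟨c.zero, hc⟩ (hm Y) (hn Y)⟩
  deflationClosed := by
    rintro c hc ⟨m, hm⟩ ⟨n, hn⟩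
    have hm := hS.projDimLE_mono (le_max_left m n) hm
    have hn := hS.projDimLE_mono ((le_max_right m n).trans (Nat.le_succ _)) hn
    exact ⟨max m n, fun Y => hS.subsingleton_ext_left ⟨c.zero, hc⟩ (hm Y) (hn Y)⟩

/-! ### Coresolutions and approximations -/

lemma exists_ses_of_isPullback {K E X X' E' : C} {i : K ⟶ E} {p : E ⟶ X} (h : SES S i p)
    {a : X' ⟶ X} {g : E' ⟶ E} {p' : E' ⟶ X'} (hP : IsPullback g p' p a) :
    ∃ i' : K ⟶ E', SES S i' p' ∧ i' ≫ g = i := by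
  obtain ⟨E'', i'', p'', g'', h'', hP'', hg⟩ := hS.exists_ses_pullback h a
  have hp := IsPullback.isoIsPullback_inv_snd _ _ hP'' hP
  have hg' := IsPullback.isoIsPullback_hom_fst _ _ hP'' hP
  refine ⟨i'' ≫ (IsPullback.isoIsPullback _ _ hP'' hP).hom, hS.ses_of_iso h'' (Iso.refl _)
    (IsPullback.isoIsPullback _ _ hP'' hP) (Iso.refl _) (by simp) (by simp), ?_⟩
  rw [Category.assoc, hg', hg]

lemma exists_section_of_subsingleton {K E X : C} {i : K ⟶ E} {p : E ⟶ X} (h : SES S i p)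
    (hX : Subsingleton (Ext S 1 X K)) : ∃ s : X ⟶ E, s ≫ p = 𝟙 X :=
  hS.subsingleton_ext_iff.1 hX (.single E i p h.1 h.2)

lemma subsingleton_ext_one_iff {X Y : C} : Subsingleton (Ext S 1 X Y) ↔
    ∀ (E : C) (i : Y ⟶ E) (p : E ⟶ X), SES S i p → ∃ s : X ⟶ E, s ≫ p = 𝟙 X := by
  refine ⟨fun h E i p hp => hS.exists_section_of_subsingleton hp h, fun h => ?_⟩
  rw [hS.subsingleton_ext_iff]
  intro ξ
  cases ξ with
  | single E i p w hE => exact h E i p ⟨w, hE⟩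

lemma isStableUnderRetracts_perp (T : ObjectProperty C) : (perp S T).IsStableUnderRetracts where
  of_retract r h
    | 0, hi => absurd hi (by simp)
    | i + 1, hi => fun X hX => hS.subsingleton_ext_of_retract_right r (h (i + 1) hi X hX)

lemma isStableUnderRetracts_extProjectives {𝒳 : ObjectProperty C} (h𝒳 : 𝒳.IsStableUnderRetracts) :
    (extProjectives S 𝒳).IsStableUnderRetracts where
  of_retract r h := ⟨h𝒳.of_retract r h.1, fun M hM =>
    hS.subsingleton_ext_of_retract r (h.2 M hM)⟩

lemma cores_succ {𝒳 : ObjectProperty C} (h𝒳 : InflationClosed S 𝒳) {n : ℕ} {M : C}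
    (hM : Cores S 𝒳 n M) : Cores S 𝒳 (n + 1) M := by
  induction n generalizing M with
  | zero =>
    obtain ⟨X₀, hX₀, ⟨e⟩⟩ := hM
    obtain ⟨Z, hZ, h⟩ := hS.exists_id_ses X₀
    have h' : SES S e.hom (0 : X₀ ⟶ Z) :=
      hS.ses_of_iso h e.symm (Iso.refl _) (Iso.refl _) (by simp) (by simp)
    exact ⟨X₀, Z, _, _, h'.1, h'.2, hX₀, Z, h𝒳 _ h.choose_spec hX₀ hX₀, ⟨Iso.refl _⟩⟩
  | succ n ih =>
    obtain ⟨X₀, N, i, p, w, h, hX₀, hN⟩ := hM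
    exact ⟨X₀, N, i, p, w, h, hX₀, ih hN⟩

omit hS in
lemma _root_.QuillenExact.IsThick.prop_of_cores {L 𝒳 : ObjectProperty C} (hL : IsThick S L)
    (h𝒳 : 𝒳 ≤ L) {n : ℕ} {M : C} (hM : Cores S 𝒳 n M) : L M := by
  induction n generalizing M with
  | zero =>
    obtain ⟨X₀, hX₀, ⟨e⟩⟩ := hM
    exact hL.summands.of_retract e.retract (h𝒳 _ hX₀)
  | succ n ih =>
    obtain ⟨X₀, N, i, p, w, h, hX₀, hN⟩ := hM
    exact hL.deflationClosed _ h (h𝒳 _ hX₀) (ih hN)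

lemma subsingleton_ext_of_cores_left {𝒳 : ObjectProperty C} {M : C}
    (h : ∀ (i : ℕ) (X : C), 𝒳 X → Subsingleton (Ext S (i + 1) X M)) {n : ℕ} {Y : C}
    (hY : Cores S 𝒳 n Y) (i : ℕ) : Subsingleton (Ext S (i + 1) Y M) := by
  induction n generalizing Y i with
  | zero =>
    obtain ⟨X₀, hX₀, ⟨e⟩⟩ := hY
    exact hS.subsingleton_ext_of_retract e.retract (h i X₀ hX₀)
  | succ n ih =>
    obtain ⟨X₀, N, j, p, w, hj, hX₀, hN⟩ := hY
    exact hS.subsingleton_ext_left ⟨w, hj⟩ (h i X₀ hX₀) (ih hN (i + 1))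

/-- An object of `T` has no extensions of length more than `n` by an object of `Coresₙ(T^⊥)`. -/
lemma subsingleton_ext_of_cores_perp {T : ObjectProperty C} {X : C} (hX : T X) {n : ℕ} {M : C}
    (hM : Cores S (perp S T) n M) {i : ℕ} (hi : n ≤ i) : Subsingleton (Ext S (i + 1) X M) := by
  induction n generalizing M i with
  | zero =>
    obtain ⟨X₀, hX₀, ⟨e⟩⟩ := hM
    exact hS.subsingleton_ext_of_retract_right e.retract (hX₀ _ (by simp) X hX)
  | succ n ih =>
    obtain ⟨i, rfl⟩ := Nat.exists_eq_add_of_le' (Nat.one_le_of_lt hi)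
    obtain ⟨X₀, N, j, p, w, hj, hX₀, hN⟩ := hM
    exact hS.subsingleton_ext_of_ses_right ⟨w, hj⟩ (ih hN (by omega)) (hX₀ _ (by simp) X hX)

end IsExactCategory

namespace IsTilting

variable {T : ObjectProperty C}

lemma exists_ses_of_perp (hT : IsTilting S T) {M : C} (hM : perp S T M) :
    ∃ (K P : C) (i : K ⟶ P) (p : P ⟶ M), SES S i p ∧ perp S T K ∧ T P := by
  obtain ⟨K, P, i, p, w, h, hK, hP⟩ := hT.enoughProjectives M hM
  exact ⟨K, P, i, p, ⟨w, h⟩, hK, by rwa [hT.projectives_eq] at hP⟩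

/-- The left approximation of the kernel `M` of `W ⟶ N` obtained from a right approximation of
`N`. -/
lemma exists_left_approximation_of_ses (hS : IsExactCategory S) (hT : IsTilting S T)
    {M W N K Y : C} {i : M ⟶ W} {p : W ⟶ N} {j : K ⟶ Y} {q : Y ⟶ N} (h : SES S i p)
    (hW : perp S T W) (h' : SES S j q) (hK : perp S T K) :
    ∃ (E : C) (a : M ⟶ E) (b : E ⟶ Y), SES S a b ∧ perp S T E := by
  obtain ⟨E, a, b, g, hb, hP, -⟩ := hS.exists_ses_pullback h q
  obtain ⟨k, hk, -⟩ := hS.exists_ses_of_isPullback h' hP.flip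
  exact ⟨E, a, b, hb, hT.coresolving.extensionClosed _ hk.choose_spec hK hW⟩

variable (hS : IsExactCategory S) (hT : IsTilting S T)
include hS hT

/-- Each object of `Coresₙ(T^⊥)` has a right approximation by an object of `Coresₙ(T)`, with kernel
in `T^⊥`. -/
lemma exists_right_approximation {n : ℕ} {M : C} (hM : Cores S (perp S T) n M) :
    ∃ (K Z : C) (j : K ⟶ Z) (q : Z ⟶ M), SES S j q ∧ perp S T K ∧ Cores S T n Z := by
  induction n generalizing M with
  | zero =>
    obtain ⟨X₀, hX₀, ⟨e⟩⟩ := hM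
    obtain ⟨K, P, i, p, h, hK, hP⟩ := hT.exists_ses_of_perp
      ((hS.isStableUnderRetracts_perp T).of_retract e.retract hX₀)
    exact ⟨K, P, i, p, h, hK, P, hP, ⟨Iso.refl P⟩⟩
  | succ n ih =>
    obtain ⟨W, N, i, p, w, h, hW, hN⟩ := hM
    obtain ⟨K, Y, j, q, hq, hK, hY⟩ := ih hN
    obtain ⟨E, a, b, hb, hE⟩ := exists_left_approximation_of_ses hS hT ⟨w, h⟩ hW hq hK
    obtain ⟨K', P, k, t, ht, hK', hP⟩ := hT.exists_ses_of_perp hE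
    obtain ⟨Z, m, j', q', hm, hj', -⟩ := hS.exists_ses_comp ht hb
    exact ⟨K', Z, j', q', hj', hK', P, Y, m, _, hm.1, hm.2, hP, hY⟩

/-- Each object of `Coresₙ₊₁(T^⊥)` has a left approximation by an object of `T^⊥`, with cokernel
in `Coresₙ(T)`. -/
lemma exists_left_approximation {n : ℕ} {M : C} (hM : Cores S (perp S T) (n + 1) M) :
    ∃ (E Y : C) (a : M ⟶ E) (b : E ⟶ Y), SES S a b ∧ perp S T E ∧ Cores S T n Y := by
  obtain ⟨W, N, i, p, w, h, hW, hN⟩ := hM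
  obtain ⟨K, Y, j, q, hq, hK, hY⟩ := hT.exists_right_approximation hS hN
  obtain ⟨E, a, b, hb, hE⟩ := exists_left_approximation_of_ses hS hT ⟨w, h⟩ hW hq hK
  exact ⟨E, Y, a, b, hb, hE, hY⟩

/-- Objects of `T^⊥` of finite projective dimension have finite resolutions by objects of `T`. -/
lemma prop_of_perp {L : ObjectProperty C} (hL : IsThick S L) (hTL : T ≤ L) {m : ℕ} {W : C}
    (hW : perp S T W) (h : ∀ M : C, perp S T M → Subsingleton (Ext S (m + 1) W M)) : L W := by
  induction m generalizing W with
  | zero =>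
    apply hTL
    rw [← hT.projectives_eq]
    exact ⟨hW, h⟩
  | succ m ih =>
    obtain ⟨K, P, i, p, hp, hK, hP⟩ := hT.exists_ses_of_perp hW
    exact hL.inflationClosed _ hp.choose_spec
      (ih hK fun M hM => hS.subsingleton_ext_left hp (hM _ (by simp) P hP) (h M hM)) (hTL _ hP)

end IsTilting

namespace IsNTilting

variable (hS : IsExactCategory S) {n : ℕ} {T : ObjectProperty C} (hT : IsNTilting S n T)
include hS hT

lemma le_finiteProjDim : T ≤ finiteProjDim S := fun _ hX =>
  ⟨n, fun Y => hS.subsingleton_ext_of_cores_perp hX (hT.cores_eq_top Y) le_rfl⟩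

/-- For an object of finite projective dimension, both the kernel and the middle term of a right
approximation belong to the thick closure of `T`. -/
lemma thick_eq_finiteProjDim : Thick S T = finiteProjDim S := by
  have hP := hS.isThick_finiteProjDim
  refine le_antisymm (fun M hM => hM _ hP (hT.le_finiteProjDim hS)) (fun M hM L hL hTL => ?_)
  obtain ⟨K, Z, j, q, hq, hK, hZ⟩ :=
    hT.toIsTilting.exists_right_approximation hS (hT.cores_eq_top M)
  obtain ⟨m, hm⟩ := hP.deflationClosed _ hq.choose_spec
    (IsThick.prop_of_cores hP (hT.le_finiteProjDim hS) hZ) hM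
  exact hL.inflationClosed _ hq.choose_spec
    (hT.toIsTilting.prop_of_perp hS hL hTL hK fun M _ => hm M)
    (IsThick.prop_of_cores hL hTL hZ)

end IsNTilting

/-! ### Thick subcategories as exact categories -/

lemma ses_restrict_iff {P : ObjectProperty C} {K E X : P.FullSubcategory} {i : K ⟶ E} {p : E ⟶ X} :
    SES (restrict S P) i p ↔ SES S i.hom p.hom :=
  ⟨fun h => ⟨congrArg (·.hom) h.zero, h.choose_spec⟩, fun h => ⟨P.hom_ext h.zero, h.choose_spec⟩⟩

namespace IsThick

variable {P : ObjectProperty C}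

lemma prop_of_isZero (hP : IsThick S P) (hS : IsExactCategory S) {X Z : C} (hX : P X)
    (hZ : IsZero Z) : P Z :=
  hP.inflationClosed _ (hS.ses_id_of_isZero X hZ).choose_spec hX hX

lemma hasFiniteBiproducts (hP : IsThick S P) (hS : IsExactCategory S) {X₀ : C} (hX₀ : P X₀) :
    HasFiniteBiproducts P.FullSubcategory := by
  have := hS.hasFiniteBiproducts
  have : HasZeroObject C := hasZeroObject_of_hasFiniteBiproducts C
  have := hasBinaryBiproducts_of_finite_biproducts C
  obtain ⟨O, hO⟩ := HasZeroObject.zero (C := C)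
  have : P.ContainsZero := ⟨O, hO, hP.prop_of_isZero hS hX₀ hO⟩
  have := hP.summands
  have : P.IsClosedUnderBinaryProducts := ⟨by
    rintro X ⟨p⟩
    have e : X ≅ p.diag.obj ⟨.left⟩ ⊞ p.diag.obj ⟨.right⟩ :=
      p.isLimit.conePointsIsoOfNatIso (BinaryBiproduct.isLimit _ _) (diagramIsoPair p.diag)
    refine P.prop_of_retract e.retract ?_
    obtain ⟨Q, i, q, s, r, hQ, hsq, hir, hsr⟩ :=
      hS.exists_ses_split (p.diag.obj ⟨.left⟩) (p.diag.obj ⟨.right⟩)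
    refine P.prop_of_retract ⟨biprod.desc i s, biprod.lift r q, ?_⟩
      (hP.extensionClosed _ hQ.choose_spec (p.prop_diag_obj _) (p.prop_diag_obj _))
    ext <;> simp [hir, hsr, hsq, hQ.zero]⟩
  have : P.IsClosedUnderFiniteProducts := .mk'
  exact HasFiniteBiproducts.of_hasFiniteProducts

/-- A thick subcategory inherits the exact structure, since it is closed under extensions. -/
lemma isExactCategory_restrict (hP : IsThick S P) (hS : IsExactCategory S) {X₀ : C} (hX₀ : P X₀) :
    IsExactCategory (restrict S P) where
  hasFiniteBiproducts := hP.hasFiniteBiproducts hS hX₀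
  isKernel c hc := by
    have h : SES S c.f.hom c.g.hom := ses_restrict_iff.1 ⟨c.zero, hc⟩
    have := hS.mono h
    have : Mono c.f := P.ι.mono_of_mono_map (f := c.f) this
    refine ⟨KernelFork.IsLimit.ofι' c.f c.zero fun {A} k hk =>
      ⟨P.homMk (hS.exists_lift h k.hom (congrArg (·.hom) hk)).choose, ?_⟩⟩
    ext
    exact (hS.exists_lift h k.hom (congrArg (·.hom) hk)).choose_spec
  isCokernel c hc := by
    have h : SES S c.f.hom c.g.hom := ses_restrict_iff.1 ⟨c.zero, hc⟩
    have := hS.epi h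
    have : Epi c.g := P.ι.epi_of_epi_map (f := c.g) this
    refine ⟨CokernelCofork.IsColimit.ofπ' c.g c.zero fun {A} k hk =>
      ⟨P.homMk (hS.exists_desc h k.hom (congrArg (·.hom) hk)).choose, ?_⟩⟩
    ext
    exact (hS.exists_desc h k.hom (congrArg (·.hom) hk)).choose_spec
  closedUnderIso := by
    have := hS.closedUnderIso
    exact inferInstanceAs (S.inverseImage P.ι.mapShortComplex).IsClosedUnderIsomorphisms
  inflation_id A := by
    obtain ⟨Z, hZ, h⟩ := hS.exists_id_ses A.obj
    exact ⟨⟨Z, hP.prop_of_isZero hS hX₀ hZ⟩, P.homMk 0, ses_restrict_iff.2 h⟩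
  deflation_id A := by
    obtain ⟨Z, hZ, h⟩ := hS.exists_ses_id A.obj
    exact ⟨⟨Z, hP.prop_of_isZero hS hX₀ hZ⟩, P.homMk 0, ses_restrict_iff.2 h⟩
  inflation_comp := by
    rintro A B D i j ⟨X, p, hi⟩ ⟨Y, q, hj⟩
    obtain ⟨M, m, a, b, hm, ha, -⟩ := hS.exists_ses_comp' (ses_restrict_iff.1 hi)
      (ses_restrict_iff.1 hj)
    exact ⟨⟨M, hP.extensionClosed _ ha.choose_spec X.2 Y.2⟩, P.homMk m, ses_restrict_iff.2 hm⟩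
  deflation_comp := by
    rintro A B D i j ⟨X, p, hi⟩ ⟨Y, q, hj⟩
    obtain ⟨M, m, a, b, hm, ha, -⟩ := hS.exists_ses_comp (ses_restrict_iff.1 hi)
      (ses_restrict_iff.1 hj)
    exact ⟨⟨M, hP.extensionClosed _ ha.choose_spec X.2 Y.2⟩, P.homMk m, ses_restrict_iff.2 hm⟩
  inflation_pushout := by
    rintro A B A' i f ⟨X, p, hi⟩
    obtain ⟨E, i', p', g, hp', hE, -⟩ := hS.exists_ses_pushout (ses_restrict_iff.1 hi) f.hom
    exact ⟨⟨E, hP.extensionClosed _ hp'.choose_spec A'.2 X.2⟩, P.homMk g, P.homMk i',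
      IsPushout.of_map P.ι (P.hom_ext hE.w) hE, X, P.homMk p', ses_restrict_iff.2 hp'⟩
  deflation_pullback := by
    rintro B D D' p f ⟨A, i, hi⟩
    obtain ⟨E, i', p', g, hp', hE, -⟩ := hS.exists_ses_pullback (ses_restrict_iff.1 hi) f.hom
    exact ⟨⟨E, hP.extensionClosed _ hp'.choose_spec A.2 D'.2⟩, P.homMk g, P.homMk p',
      IsPullback.of_map P.ι (P.hom_ext hE.w) hE, A, P.homMk i', ses_restrict_iff.2 hp'⟩

lemma isIdempotentComplete_fullSubcategory (hP : IsThick S P) [IsIdempotentComplete C] :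
    IsIdempotentComplete P.FullSubcategory where
  idempotents_split X p hp := by
    obtain ⟨Y, i, e, hie, hei⟩ :=
      IsIdempotentComplete.idempotents_split X.obj p.hom (congrArg (·.hom) hp)
    exact ⟨⟨Y, hP.summands.of_retract ⟨i, e, hie⟩ X.2⟩, P.homMk i, P.homMk e, P.hom_ext hie,
      P.hom_ext hei⟩

/-- Coresolutions by objects of a thick subcategory are coresolutions within it. -/
lemma cores_restrict (hP : IsThick S P) {𝒳 : ObjectProperty C} (h𝒳 : 𝒳 ≤ P) {n : ℕ}
    {M : P.FullSubcategory} (hM : Cores S 𝒳 n M.obj) :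
    Cores (restrict S P) (𝒳.inverseImage P.ι) n M := by
  induction n generalizing M with
  | zero =>
    obtain ⟨X₀, hX₀, ⟨e⟩⟩ := hM
    exact ⟨⟨X₀, h𝒳 _ hX₀⟩, hX₀, ⟨P.isoMk e⟩⟩
  | succ n ih =>
    obtain ⟨X₀, N, i, p, w, h, hX₀, hN⟩ := hM
    have h' := (ses_restrict_iff (P := P) (K := M) (E := ⟨X₀, h𝒳 _ hX₀⟩)
      (X := ⟨N, hP.prop_of_cores h𝒳 hN⟩) (i := P.homMk i) (p := P.homMk p)).2 ⟨w, h⟩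
    exact ⟨_, _, _, _, h'.1, h'.2, hX₀, ih hN⟩

lemma subsingleton_ext_one_restrict (hP : IsThick S P) (hS : IsExactCategory S)
    {X Y : P.FullSubcategory} (h : Subsingleton (Ext S 1 X.obj Y.obj)) :
    Subsingleton (Ext (restrict S P) 1 X Y) := by
  rw [(hP.isExactCategory_restrict hS X.2).subsingleton_ext_one_iff]
  intro E i p hp
  obtain ⟨s, hs⟩ := hS.exists_section_of_subsingleton (ses_restrict_iff.1 hp) h
  exact ⟨P.homMk s, P.hom_ext hs⟩

end IsThick

lemma Cores.mono {𝒳 𝒴 : ObjectProperty C} (h : 𝒳 ≤ 𝒴) {n : ℕ} {M : C} (hM : Cores S 𝒳 n M) :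
    Cores S 𝒴 n M := by
  induction n generalizing M with
  | zero =>
    obtain ⟨X₀, hX₀, e⟩ := hM
    exact ⟨X₀, h _ hX₀, e⟩
  | succ n ih =>
    obtain ⟨X₀, N, i, p, w, hp, hX₀, hN⟩ := hM
    exact ⟨X₀, N, i, p, w, hp, h _ hX₀, ih hN⟩

/-! ### The tilting subcategory of the objects of finite projective dimension -/

namespace IsNTilting

variable (hS : IsExactCategory S) {n : ℕ} {T : ObjectProperty C} (hT : IsNTilting S n T)
include hS hT

/-- A left approximation of an object of finite projective dimension, within the subcategory of
these objects. -/
lemma exists_left_approximation {k : ℕ} {M : (finiteProjDim S).FullSubcategory}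
    (hM : Cores S (perp S T) (k + 1) M.obj) :
    ∃ (E Y : (finiteProjDim S).FullSubcategory) (a : M ⟶ E) (b : E ⟶ Y),
      SES (restrict S (finiteProjDim S)) a b ∧ perp S T E.obj ∧
        Cores (restrict S (finiteProjDim S)) (T.inverseImage (finiteProjDim S).ι) k Y := by
  have hP := hS.isThick_finiteProjDim
  have hTP := hT.le_finiteProjDim hS
  obtain ⟨E, Y, a, b, hb, hE, hY⟩ := hT.toIsTilting.exists_left_approximation hS hM
  have hYP := hP.prop_of_cores hTP hY
  exact ⟨⟨E, hP.extensionClosed _ hb.choose_spec M.2 hYP⟩, ⟨Y, hYP⟩, ObjectProperty.homMk a,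
    ObjectProperty.homMk b, ses_restrict_iff.2 hb, hE, hP.cores_restrict hTP hY⟩

lemma isCoresolving_restrict : IsCoresolving (restrict S (finiteProjDim S))
    ((perp S T).inverseImage (finiteProjDim S).ι) where
  extensionClosed _ hc h₁ h₃ := hT.coresolving.extensionClosed _ hc h₁ h₃
  inflationClosed _ hc h₁ h₂ := hT.coresolving.inflationClosed _ hc h₁ h₂
  cogenerating M := by
    obtain ⟨E, Y, a, b, hb, hE, -⟩ := hT.exists_left_approximation hS (M := M)
      (hS.cores_succ hT.coresolving.inflationClosed (hT.cores_eq_top M.obj))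
    exact ⟨E, a, hE, hb.isInflation⟩

/-- The subcategory `T^⊥` formed among the objects of finite projective dimension consists of the
objects of `T^⊥` of finite projective dimension. -/
lemma perp_restrict : perp (restrict S (finiteProjDim S)) (T.inverseImage (finiteProjDim S).ι) =
    (perp S T).inverseImage (finiteProjDim S).ι := by
  have hP := hS.isThick_finiteProjDim
  refine le_antisymm (fun M hM => ?_) (fun M hM i hi X hX => ?_)
  · have hS' := hP.isExactCategory_restrict hS M.2
    obtain ⟨E, Y, a, b, hb, hE, hY⟩ := hT.exists_left_approximation hS (M := M)
      (hS.cores_succ hT.coresolving.inflationClosed (hT.cores_eq_top M.obj))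
    obtain ⟨s, hs⟩ := hS'.exists_section_of_subsingleton hb
      (hS'.subsingleton_ext_of_cores_left (fun i X hX => hM (i + 1) (by simp) X hX) hY 0)
    obtain ⟨r, hr, -⟩ := hS'.exists_retraction hb s hs
    exact (hS.isStableUnderRetracts_perp T).of_retract
      ⟨a.hom, r.hom, congrArg (·.hom) hr⟩ hE
  · obtain ⟨i, rfl⟩ := Nat.exists_eq_add_of_le' hi
    exact (hP.isExactCategory_restrict hS M.2).subsingleton_ext_of_isCoresolving
      (hT.isCoresolving_restrict hS)
      (fun N hN => hP.subsingleton_ext_one_restrict hS (hN 1 le_rfl X.obj hX)) i hM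

lemma le_extProjectives_restrict : T.inverseImage (finiteProjDim S).ι ≤
    extProjectives (restrict S (finiteProjDim S))
      ((perp S T).inverseImage (finiteProjDim S).ι) := fun X hX =>
  ⟨hT.selfOrthogonal _ hX, fun _ hM =>
    hS.isThick_finiteProjDim.subsingleton_ext_one_restrict hS (hM 1 le_rfl X.obj hX)⟩

lemma exists_ses_of_perp_restrict {M : (finiteProjDim S).FullSubcategory}
    (hM : perp S T M.obj) : ∃ (K Q : (finiteProjDim S).FullSubcategory) (i : K ⟶ Q) (p : Q ⟶ M),
      SES (restrict S (finiteProjDim S)) i p ∧ perp S T K.obj ∧ T Q.obj := by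
  obtain ⟨K, Q, i, p, hp, hK, hQ⟩ := hT.toIsTilting.exists_ses_of_perp hM
  have hQP := hT.le_finiteProjDim hS _ hQ
  exact ⟨⟨K, hS.isThick_finiteProjDim.deflationClosed _ hp.choose_spec hQP M.2⟩, ⟨Q, hQP⟩,
    ObjectProperty.homMk i, ObjectProperty.homMk p, ses_restrict_iff.2 hp, hK, hQ⟩

lemma extProjectives_restrict : extProjectives (restrict S (finiteProjDim S))
    ((perp S T).inverseImage (finiteProjDim S).ι) = T.inverseImage (finiteProjDim S).ι := by
  refine le_antisymm (fun X hX => ?_) (hT.le_extProjectives_restrict hS)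
  have hS' := hS.isThick_finiteProjDim.isExactCategory_restrict hS X.2
  obtain ⟨K, Q, i, p, hp, hK, hQ⟩ := hT.exists_ses_of_perp_restrict hS hX.1
  obtain ⟨s, hs⟩ := hS'.exists_section_of_subsingleton hp (hX.2 K hK)
  have := (hS.isStableUnderRetracts_extProjectives (hS.isStableUnderRetracts_perp T)).of_retract
    (X := X.obj) (Y := Q.obj) ⟨s.hom, p.hom, congrArg (·.hom) hs⟩
  rw [hT.projectives_eq] at this
  exact this hQ

lemma cores_restrict (M : (finiteProjDim S).FullSubcategory) :
    Cores (restrict S (finiteProjDim S)) ((perp S T).inverseImage (finiteProjDim S).ι) n M := by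
  have hM := hT.cores_eq_top M.obj
  cases n with
  | zero =>
    obtain ⟨X₀, hX₀, ⟨e⟩⟩ := hM
    exact ⟨M, (hS.isStableUnderRetracts_perp T).of_retract e.retract hX₀, ⟨Iso.refl M⟩⟩
  | succ n =>
    obtain ⟨E, Y, a, b, hb, hE, hY⟩ := hT.exists_left_approximation hS hM
    exact ⟨E, Y, a, b, hb.1, hb.2, hE, hY.mono fun X hX => hT.selfOrthogonal _ hX⟩

lemma isNTilting_restrict : IsNTilting (restrict S (finiteProjDim S)) n
    (T.inverseImage (finiteProjDim S).ι) where
  selfOrthogonal := by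
    rw [hT.perp_restrict hS]
    exact fun X hX => hT.selfOrthogonal _ hX
  enoughProjectives := by
    rw [hT.perp_restrict hS]
    intro M hM
    obtain ⟨K, Q, i, p, hp, hK, hQ⟩ := hT.exists_ses_of_perp_restrict hS hM
    exact ⟨K, Q, i, p, hp.1, hp.2, hK, hT.le_extProjectives_restrict hS _ hQ⟩
  projectives_eq := by
    rw [hT.perp_restrict hS, hT.extProjectives_restrict hS]
  coresolving := by
    rw [hT.perp_restrict hS]
    exact hT.isCoresolving_restrict hS
  finitelyCoresolving M := by
    rw [hT.perp_restrict hS]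
    exact ⟨n + 1, by simp, (hS.isThick_finiteProjDim.isExactCategory_restrict hS M.2).cores_succ
      (hT.isCoresolving_restrict hS).inflationClosed (hT.cores_restrict hS M)⟩
  cores_eq_top M := by
    rw [hT.perp_restrict hS]
    exact hT.cores_restrict hS M

end IsNTilting

lemma IsExactCategory.exists_finiteProjDim (hS : IsExactCategory S) :
    ∃ X : C, finiteProjDim S X := by
  have := hS.hasFiniteBiproducts
  have : HasZeroObject C := hasZeroObject_of_hasFiniteBiproducts C
  obtain ⟨O, hO⟩ := HasZeroObject.zero (C := C)
  refine ⟨O, 0, fun Y => ?_⟩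
  rw [hS.subsingleton_ext_iff]
  intro ξ
  rw [hO.eq_of_src (𝟙 O) 0]
  exact hS.trivAlong_zero ξ O

end

end QuillenExact

theorem mainTheorem10 {C : Type u} [Category.{v} C] [Preadditive C] [IsIdempotentComplete C]
    (S : ObjectProperty (ShortComplex C)) (hS : QuillenExact.IsExactCategory S)
    (n : ℕ) (T : ObjectProperty C) (hT : QuillenExact.IsNTilting S n T) :
    QuillenExact.Thick S T = QuillenExact.finiteProjDim S ∧
    (QuillenExact.ExtensionClosed S (QuillenExact.finiteProjDim S) ∧
      QuillenExact.IsExactCategory (QuillenExact.restrict S (QuillenExact.finiteProjDim S)) ∧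
      IsIdempotentComplete (QuillenExact.finiteProjDim S).FullSubcategory) ∧
    QuillenExact.IsNTilting (QuillenExact.restrict S (QuillenExact.finiteProjDim S)) n
      (T.inverseImage (QuillenExact.finiteProjDim S).ι) := by
  have hP := hS.isThick_finiteProjDim
  obtain ⟨X₀, hX₀⟩ := hS.exists_finiteProjDim
  exact ⟨hT.thick_eq_finiteProjDim hS, ⟨hP.extensionClosed, hP.isExactCategory_restrict hS hX₀,
    hP.isIdempotentComplete_fullSubcategory⟩, hT.isNTilting_restrict hS⟩
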